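/- All germs are at the origin of $\mathbb{C}^2$, which carries its Euclidean norm. A \emph{plane branch} is the germ at $0$ of an analytically irreducible complex curve in $\mathbb{C}^2$, i.e. the germ of the zero set $\{F=0\}$ of an irreducible element $F$ of the ring of germs of holomorphic functions at $0\in\mathbb{C}^2$. For plane branches $\Gamma_1,\Gamma_2$ put $$\mathrm{Cont}(\Gamma_1,\Gamma_2)=\lim_{r\to0^+}\frac{\ln f_{\Gamma_1,\Gamma_2}(r)}{\ln r},\qquad f_{\Gamma_1,\Gamma_2}(r)=\inf\{\|\gamma_1-\gamma_2\| : \gamma_i\in\Gamma_i,\ \|\gamma_i\|\ge r,\ i=1,2\},$$ where $\Gamma_i$ is replaced by its intersection with a sufficiently small closed ball around $0$ and $\ln 0=-\infty$ (so that $\mathrm{Cont}(\Gamma_1,\Gamma_2)=+\infty$ if $\Gamma_1=\Gamma_2$). For $\alpha>0$, two germs $(X,0)$ and $(Y,0)$ are \emph{$\alpha$-H\"older homeomorphic} if there are neighbourhoods $U,V$ of $0$ and a homeomorphism $h\colon X\cap U\to Y\cap V$ with $h(0)=0$ such that $h$ and $h^{-1}$ are $\alpha$-H\"older, i.e. satisfy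 $\|h(p)-h(q)\|\le K\|p-q\|^{\alpha}$ (respectively the same for $h^{-1}$) for some $K>0$ and all $p,q$. \textbf{Theorem.} Let $C_1,C_2,\tilde C_1,\tilde C_2$ be plane branches. Then the limits $\mathrm{Cont}(C_1,C_2)$ and $\mathrm{Cont}(\tilde C_1,\tilde C_2)$ exist in $[-\infty,+\infty]$ and do not depend on the choice of a sufficiently small ball. If $\mathrm{Cont}(C_1,C_2)\neq\mathrm{Cont}(\tilde C_1,\tilde C_2)$, then there exists $0<\alpha<1$ such that $C_1\cup C_2$ is not $\alpha$-H\"older homeomorphic to $\tilde C_1\cup\tilde C_2$. -/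

import Mathlib

open Filter Topology
open scoped NNReal ENNReal

namespace HolderCurves

/-- The plane `ℂ²` with its Euclidean (Hermitian) norm. -/
abbrev Plane : Type := EuclideanSpace ℂ (Fin 2)

/-- The germ at `0` of `F` is an irreducible element of the ring of germs at `0 ∈ ℂ²` of
holomorphic functions, i.e. of `ℂ{x, y}`. The units of this ring are the germs that do not vanish
at `0`; the zero germ is excluded by the factorization `0 = 0 * 0`. -/
structure IsIrreducibleGerm (F : Plane → ℂ) : Prop where
  analyticAt : AnalyticAt ℂ F 0
  apply_zero : F 0 = 0
  unit_or_unit : ∀ G H : Plane → ℂ, AnalyticAt ℂ G 0 → AnalyticAt ℂ H 0 →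
    (∀ᶠ p in 𝓝 0, F p = G p * H p) → G 0 ≠ 0 ∨ H 0 ≠ 0

/-- The germ at `0` of `C` is a plane branch, i.e. the germ of an analytically irreducible complex
plane curve: near `0`, it is the zero set of an irreducible holomorphic germ. -/
def IsPlaneBranch (C : Set Plane) : Prop :=
  ∃ F : Plane → ℂ, IsIrreducibleGerm F ∧ ∀ᶠ p in 𝓝 0, p ∈ C ↔ F p = 0

/-- `f(r) = inf {‖γ₁ - γ₂‖ : γᵢ ∈ Γᵢ, ‖γᵢ‖ ≥ r}`, for sets `Γ₁`, `Γ₂`. -/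
noncomputable def gap {E : Type*} [NormedAddCommGroup E] (Γ₁ Γ₂ : Set E) (r : ℝ) : ℝ≥0∞ :=
  ⨅ (γ₁ ∈ Γ₁) (γ₂ ∈ Γ₂) (_ : r ≤ ‖γ₁‖) (_ : r ≤ ‖γ₂‖), edist γ₁ γ₂

/-- The contact of the germs at `0` of `Γ₁` and `Γ₂` exists and equals `c`, i.e.
`c = lim_{r → 0⁺} ln f(r) / ln r`, where `ln 0 = -∞` and `f` is computed from sufficiently small
representatives of the two germs (large representatives could be close to each other, or meet, away
from the origin). -/
def HasContact {E : Type*} [NormedAddCommGroup E] (Γ₁ Γ₂ : Set E) (c : EReal) : Prop :=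
  ∀ᶠ ε in 𝓝[>] (0 : ℝ),
    Tendsto
      (fun r : ℝ =>
        ENNReal.log (gap (Γ₁ ∩ Metric.closedBall 0 ε) (Γ₂ ∩ Metric.closedBall 0 ε) r)
          / ((Real.log r : ℝ) : EReal))
      (𝓝[>] 0) (𝓝 c)

/-- The contact is unique. -/
theorem HasContact.unique {E : Type*} [NormedAddCommGroup E] {Γ₁ Γ₂ : Set E} {c d : EReal}
    (hc : HasContact Γ₁ Γ₂ c) (hd : HasContact Γ₁ Γ₂ d) : c = d := by
  obtain ⟨ε, h₁, h₂⟩ := (hc.and hd).exists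
  exact tendsto_nhds_unique h₁ h₂

/-- The germ `(X, x₀)` is `α`-Hölder homeomorphic to the germ `(Y, y₀)`: there is a homeomorphism
between representatives that sends `x₀` to `y₀` and is `α`-Hölder, as is its inverse. -/
def IsHolderHomeomorphic {E F : Type*} [MetricSpace E] [MetricSpace F] (α : ℝ≥0)
    (X : Set E) (x₀ : E) (Y : Set F) (y₀ : F) : Prop :=
  ∃ U ∈ 𝓝 x₀, ∃ V ∈ 𝓝 y₀, ∃ f : ↥(X ∩ U) ≃ₜ ↥(Y ∩ V),
    (∃ h : x₀ ∈ X ∩ U, (f ⟨x₀, h⟩ : F) = y₀) ∧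
    (∃ K : ℝ≥0, HolderWith K α f) ∧ ∃ K : ℝ≥0, HolderWith K α f.symm

end HolderCurves

/-!
Each branch is parametrized by a Puiseux series, from which both the contact and the topology of
the union of two branches can be read off.

*Parametrization.* In linear coordinates in which `F(0, y)` does not vanish identically, the
Newton–Puiseux algorithm produces an analytic `y(t)` with `F(tᴺ, y(t)) = 0`
(`exists_puiseux_root`): after a Tschirnhaus translation, the weighted substitution along the first
side of the Newton polygon leads to a germ of smaller order in `y`, so that neither the preparation
theorem nor monodromy is needed. The product `Q(t, y)` of `y - y(ωᵏt)` over the distinct rotations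
of this root divides `F(tᴺ, y)`, and `Q` and the cofactor depend on `t` only through `tᴺ`. As `F` is
irreducible, the cofactor is a unit, and the branch is the image of `t ↦ (tᴺ, y(t))`
(`exists_parametrization`). The divisions in two variables rest on Osgood's lemma
(`analyticAt_of_separately`).

*Contact.* Two branches are parametrized as `(tᴺ, y₁(t))` and `(tᴺ, y₂(t))` in common coordinates
transversal to their tangents, so that `yᵢ(t) = O(tᴺ)`. By Cauchy's estimate the branches are then
Lipschitz over the `x`-axis, and the distance from `(tᴺ, y₁(t))` to the second branch is comparable
to the minimum of `|y₁(t) - y₂(ζt)|` over `ζᴺ = 1`, hence to a power `|t|^κ` unless the branches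
coincide (`exists_separation`). So the contact is `κ / N` or `+∞` (`exists_hasContact`).

*Hölder maps.* A branch minus the origin is the image of a punctured disc, hence connected, and two
branches of finite contact meet only at the origin. Therefore a homeomorphism of germs
`C₁ ∪ C₂ → D₁ ∪ D₂` matches the branches whenever `C₁`, `C₂` have the smaller contact, which is then
finite. If it and its inverse are `α`-Hölder, then pulling back points of `D₁`, `D₂` at distance at
least `r` from `0` and at most `r ^ d` from each other shows that the contact of `C₁`, `C₂` is at
least `α² d` (`HolderPair.false_of_matching`). This is false for `α` close to `1` if `d` is larger
than the contact of `C₁`, `C₂`.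
-/

namespace HolderCurves

open Metric Complex

/-! ### Analytic functions of two variables -/

/-- **Osgood's lemma**: a function of two complex variables that is continuous on a torus and
separately holomorphic inside is analytic. The Cauchy formula in the first variable is read in the
Banach space of continuous functions on the circle, and the Cauchy formula in the second variable
is a continuous linear functional applied to the analytic kernel `y ↦ (w ↦ (w - y)⁻¹)`. -/
theorem analyticAt_of_separately {f : ℂ × ℂ → ℂ} {ρ : ℝ} (hρ : 0 < ρ)
    (hc : ContinuousOn f (sphere 0 ρ ×ˢ sphere 0 ρ))
    (h1 : ∀ w ∈ sphere (0 : ℂ) ρ, DiffContOnCl ℂ (fun s => f (s, w)) (ball 0 ρ))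
    (h2 : ∀ x ∈ ball (0 : ℂ) ρ, DiffContOnCl ℂ (fun w => f (x, w)) (ball 0 ρ)) :
    AnalyticAt ℂ f 0 := by
  classical
  let K := sphere (0 : ℂ) ρ
  have : CompactSpace K := isCompact_iff_compactSpace.1 (isCompact_sphere 0 ρ)
  let cm : ℝ → K := fun θ => ⟨circleMap 0 ρ θ, circleMap_mem_sphere 0 hρ.le θ⟩
  have hcm : Continuous cm := (continuous_circleMap 0 ρ).subtype_mk _
  -- the restriction of `f` to the torus, as a curve of continuous functions
  let G : C(K × K, ℂ) := ⟨fun q => f (q.1, q.2), by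
    refine hc.comp_continuous (by fun_prop) ?_
    rintro ⟨a, b⟩
    exact ⟨a.2, b.2⟩⟩
  let Φ : ℂ → C(K, ℂ) := fun s => if h : s ∈ sphere (0 : ℂ) ρ then G.curry ⟨s, h⟩ else 0
  have hΦ : ∀ s (h : s ∈ sphere (0 : ℂ) ρ) (w : K), Φ s w = f (s, w) := by
    intro s h w
    simp only [Φ, dif_pos h]
    rfl
  have hΦc : ContinuousOn Φ (sphere 0 ρ) := by
    rw [continuousOn_iff_continuous_domRestrict]
    convert G.curry.continuous using 1
    ext s w
    rw [Set.domRestrict_apply, hΦ s s.2 w]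
    rfl
  lift ρ to ℝ≥0 using hρ.le
  have hci : CircleIntegrable Φ 0 ρ := hΦc.circleIntegrable ρ.2
  have hΦa := (hasFPowerSeriesOn_cauchy_integral hci (by exact_mod_cast hρ)).analyticAt
  set Ψ : ℂ → C(K, ℂ) := fun w => (2 * Real.pi * I : ℂ)⁻¹ • ∮ z in C(0, ρ), (z - w)⁻¹ • Φ z
    with hΨ
  have hΨe : ∀ x ∈ ball (0 : ℂ) ρ, ∀ w : K, Ψ x w = f (x, w) := by
    intro x hx w
    have hcont : CircleIntegrable (fun z => (z - x)⁻¹ • Φ z) 0 ρ := by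
      have hsub : ContinuousOn (fun z : ℂ => z - x) (sphere 0 ρ) := by fun_prop
      refine ContinuousOn.circleIntegrable ρ.2 (ContinuousOn.smul (hsub.inv₀ ?_) hΦc)
      intro z hz h0
      rw [sub_eq_zero] at h0
      subst h0
      simp only [mem_sphere, mem_ball] at hz hx
      exact hx.ne hz
    have h3 : (∮ z in C(0, ρ), (z - x)⁻¹ • Φ z) w = ∮ z in C(0, ρ), (z - x)⁻¹ • f (z, w) := by
      have := ((ContinuousMap.evalCLM ℂ w : C(K, ℂ) →L[ℂ] ℂ).intervalIntegral_comp_comm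
        hcont.out)
      simp only [ContinuousMap.evalCLM_apply] at this
      rw [circleIntegral, ← this, circleIntegral]
      refine intervalIntegral.integral_congr fun θ _ => ?_
      simp only [ContinuousMap.smul_apply]
      congr 2
      exact hΦ _ (circleMap_mem_sphere 0 ρ.2 θ) w
    rw [hΨ, ContinuousMap.smul_apply, h3]
    exact (h1 w w.2).two_pi_i_inv_smul_circleIntegral_sub_inv_smul hx
  -- the Cauchy kernel in the second variable
  let W : C(K, ℂ) := ⟨fun w => (w : ℂ), continuous_subtype_val⟩
  have hWi : ∀ y ∈ ball (0 : ℂ) ρ, IsUnit (W - algebraMap ℂ C(K, ℂ) y) := by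
    intro y hy
    refine ContinuousMap.isUnit_iff_forall_ne_zero _ |>.2 fun w h0 => ?_
    have h4 : (w : ℂ) = y := by simpa [W, sub_eq_zero] using h0
    have h5 := w.2
    rw [h4] at h5
    simp only [K, mem_sphere, mem_ball] at h5 hy
    exact hy.ne h5
  let k : ℂ → C(K, ℂ) := fun y => Ring.inverse (W - algebraMap ℂ C(K, ℂ) y)
  have h0b : (0 : ℂ) ∈ ball (0 : ℂ) ρ := by simpa using hρ
  have hka : AnalyticAt ℂ k 0 := by
    have h5 : AnalyticAt ℂ (fun y : ℂ => W - algebraMap ℂ C(K, ℂ) y) 0 :=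
      analyticAt_const.sub ((Algebra.linearMap ℂ C(K, ℂ)).toContinuousLinearMap.analyticAt 0)
    exact AnalyticAt.fun_comp (analyticOnNhd_inverse (𝕜 := ℂ) _ (hWi 0 h0b)) h5
  have hke : ∀ y ∈ ball (0 : ℂ) ρ, ∀ w : K, k y w = ((w : ℂ) - y)⁻¹ := by
    intro y hy w
    have h5 := congrArg (fun g : C(K, ℂ) => g w) (Ring.inverse_mul_cancel _ (hWi y hy))
    simp only [ContinuousMap.mul_apply, ContinuousMap.one_apply] at h5
    exact eq_inv_of_mul_eq_one_left h5
  -- the functional of integration along the circle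
  let Λ₀ : C(K, ℂ) →ₗ[ℂ] ℂ :=
    { toFun := fun g => (2 * Real.pi * I : ℂ)⁻¹ •
        ∫ θ in (0 : ℝ)..2 * Real.pi, deriv (circleMap 0 ρ) θ • g (cm θ)
      map_add' := by
        intro g h
        rw [← smul_add, ← intervalIntegral.integral_add]
        · simp [mul_add]
        all_goals
          refine Continuous.intervalIntegrable ?_ _ _
          simp only [deriv_circleMap]
          fun_prop
      map_smul' := by
        intro c g
        simp only [ContinuousMap.smul_apply, RingHom.id_apply]
        rw [smul_comm c, ← intervalIntegral.integral_smul c]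
        congr 1
        refine intervalIntegral.integral_congr fun θ _ => ?_
        exact smul_comm _ _ _ }
  have hΛ₀ : ∀ g, Λ₀ g = (2 * Real.pi * I : ℂ)⁻¹ •
      ∫ θ in (0 : ℝ)..2 * Real.pi, deriv (circleMap 0 ρ) θ • g (cm θ) := fun g => rfl
  have hΛb : ∀ g, ‖Λ₀ g‖ ≤ (ρ : ℝ) * ‖g‖ := by
    intro g
    have h6 : ‖∫ θ in (0 : ℝ)..2 * Real.pi, deriv (circleMap 0 ρ) θ • g (cm θ)‖
        ≤ (ρ * ‖g‖) * |2 * Real.pi - 0| := by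
      refine intervalIntegral.norm_integral_le_of_norm_le_const fun θ _ => ?_
      rw [norm_smul]
      refine mul_le_mul (by simp) (g.norm_coe_le_norm _) (norm_nonneg _) ρ.2
    rw [hΛ₀, norm_smul]
    have h7 : ‖(2 * Real.pi * I : ℂ)⁻¹‖ = (2 * Real.pi)⁻¹ := by
      simp [abs_of_pos Real.pi_pos]
    rw [h7, inv_mul_le_iff₀ (by positivity)]
    rw [sub_zero, abs_of_pos (by positivity)] at h6
    linarith
  let Λ : C(K, ℂ) →L[ℂ] ℂ := Λ₀.mkContinuous ρ hΛb
  have hrep : ∀ x ∈ ball (0 : ℂ) ρ, ∀ y ∈ ball (0 : ℂ) ρ, Λ (k y * Ψ x) = f (x, y) := by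
    intro x hx y hy
    rw [← (h2 x hx).two_pi_i_inv_smul_circleIntegral_sub_inv_smul hy]
    rw [LinearMap.mkContinuous_apply, hΛ₀]
    congr 1
    refine intervalIntegral.integral_congr fun θ _ => ?_
    simp only [ContinuousMap.mul_apply, hke y hy, hΨe x hx, cm, smul_eq_mul]
  have hana : AnalyticAt ℂ (fun q : ℂ × ℂ => Λ (k q.2 * Ψ q.1)) 0 := by
    have ha : AnalyticAt ℂ (fun q : ℂ × ℂ => k q.2) 0 := 
      AnalyticAt.fun_comp (g := k) (f := fun q : ℂ × ℂ => q.2) hka analyticAt_snd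
    have hb : AnalyticAt ℂ (fun q : ℂ × ℂ => Ψ q.1) 0 := 
      AnalyticAt.fun_comp (g := Ψ) (f := fun q : ℂ × ℂ => q.1) hΦa analyticAt_fst
    exact (Λ.analyticAt _).comp (ha.mul hb)
  refine hana.congr ?_
  have hn : ball (0 : ℂ) ρ ×ˢ ball (0 : ℂ) ρ ∈ 𝓝 (0 : ℂ × ℂ) :=
    prod_mem_nhds (ball_mem_nhds _ hρ) (ball_mem_nhds _ hρ)
  filter_upwards [hn] with q hq
  exact hrep q.1 hq.1 q.2 hq.2

theorem exists_forall_of_eventually_nhds_prod {P : ℂ × ℂ → Prop} (h : ∀ᶠ p in 𝓝 (0 : ℂ × ℂ), P p) :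
    ∃ r > 0, ∀ x y : ℂ, ‖x‖ < r → ‖y‖ < r → P (x, y) := by
  obtain ⟨r, hr, h⟩ := Metric.eventually_nhds_iff_ball.1 h
  refine ⟨r, hr, fun x y hx hy => h _ ?_⟩
  rw [mem_ball_zero_iff, Prod.norm_def]
  exact max_lt hx hy

theorem eventually_nhds_prod_of_forall {P : ℂ × ℂ → Prop} {r : ℝ} (hr : 0 < r)
    (h : ∀ x y : ℂ, ‖x‖ < r → ‖y‖ < r → P (x, y)) : ∀ᶠ p in 𝓝 (0 : ℂ × ℂ), P p := by
  filter_upwards [Metric.ball_mem_nhds (0 : ℂ × ℂ) hr] with p hp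
  rw [mem_ball_zero_iff, Prod.norm_def] at hp
  exact h _ _ ((le_max_left _ _).trans_lt hp) ((le_max_right _ _).trans_lt hp)

theorem _root_.AnalyticAt.fst_slice {F : ℂ × ℂ → ℂ} {x y : ℂ} (h : AnalyticAt ℂ F (x, y)) :
    AnalyticAt ℂ (fun s => F (s, y)) x :=
  AnalyticAt.fun_comp (g := F) (f := fun s : ℂ => (s, y)) h (analyticAt_id.prod analyticAt_const)

theorem _root_.AnalyticAt.snd_slice {F : ℂ × ℂ → ℂ} {x y : ℂ} (h : AnalyticAt ℂ F (x, y)) :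
    AnalyticAt ℂ (fun s => F (x, s)) y :=
  AnalyticAt.fun_comp (g := F) (f := fun s : ℂ => (x, s)) h (analyticAt_const.prod analyticAt_id)

theorem _root_.AnalyticAt.comp_prodMk {F : ℂ × ℂ → ℂ} {E : Type*} [NormedAddCommGroup E]
    [NormedSpace ℂ E] {u v : E → ℂ} {e : E}
    {a b : ℂ} (hF : AnalyticAt ℂ F (a, b)) (hu : AnalyticAt ℂ u e) (hv : AnalyticAt ℂ v e)
    (ha : u e = a) (hb : v e = b) : AnalyticAt ℂ (fun s => F (u s, v s)) e := by
  subst ha hb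
  exact AnalyticAt.fun_comp (g := F) (f := fun s => (u s, v s)) hF (hu.prod hv)

theorem _root_.AnalyticAt.comp_of_eq_apply {g : ℂ → ℂ} {E : Type*} [NormedAddCommGroup E]
    [NormedSpace ℂ E] {u : E → ℂ} {e : E}
    {a : ℂ} (hg : AnalyticAt ℂ g a) (hu : AnalyticAt ℂ u e)
    (ha : u e = a) : AnalyticAt ℂ (fun s => g (u s)) e := by
  subst ha
  exact AnalyticAt.fun_comp (g := g) (f := u) hg hu

/-- An analytic function of two variables that vanishes on the axis `y = 0` is divisible by `y`. -/
theorem exists_eq_snd_mul {F : ℂ × ℂ → ℂ} (hF : AnalyticAt ℂ F 0)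
    (h0 : ∀ᶠ x in 𝓝 (0 : ℂ), F (x, 0) = 0) :
    ∃ G : ℂ × ℂ → ℂ, AnalyticAt ℂ G 0 ∧ ∀ᶠ p in 𝓝 (0 : ℂ × ℂ), F p = p.2 * G p := by
  obtain ⟨r, hr, hA⟩ := exists_forall_of_eventually_nhds_prod hF.eventually_analyticAt
  obtain ⟨r', hr', hz⟩ := Metric.eventually_nhds_iff_ball.1 h0
  obtain ⟨ρ, hρ0, hρ⟩ := exists_between (lt_min hr hr')
  have hρr : ρ < r := hρ.trans_le (min_le_left _ _)
  have hz' : ∀ x : ℂ, ‖x‖ ≤ ρ → F (x, 0) = 0 := fun x hx =>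
    hz x (by simpa using hx.trans_lt (hρ.trans_le (min_le_right _ _)))
  let G : ℂ × ℂ → ℂ := fun p => dslope (fun y => F (p.1, y)) 0 p.2
  have hG : ∀ x y : ℂ, ‖x‖ ≤ ρ → F (x, y) = y * G (x, y) := by
    intro x y hx
    have := sub_smul_dslope (fun y => F (x, y)) 0 y
    rw [hz' x hx] at this
    simpa using this.symm
  have hG' : ∀ x y : ℂ, ‖x‖ ≤ ρ → y ≠ 0 → G (x, y) = y⁻¹ * F (x, y) := by
    intro x y hx hy
    rw [hG x y hx, inv_mul_cancel_left₀ hy]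
  have hsph : ∀ w ∈ sphere (0 : ℂ) ρ, ‖w‖ = ρ ∧ w ≠ 0 := by
    intro w hw
    have : ‖w‖ = ρ := by simpa using hw
    exact ⟨this, norm_pos_iff.1 (by rw [this]; exact hρ0)⟩
  refine ⟨G, analyticAt_of_separately hρ0 ?_ ?_ ?_, ?_⟩
  · refine ContinuousOn.congr (f := fun p : ℂ × ℂ => p.2⁻¹ * F p) ?_ ?_
    · intro p hp
      have h1 := hsph _ hp.1
      have h2 := hsph _ hp.2
      have h3 : ContinuousAt F p :=
        (hA p.1 p.2 (by rw [h1.1]; exact hρr) (by rw [h2.1]; exact hρr)).continuousAt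
      exact ((continuousAt_snd.inv₀ h2.2).mul h3).continuousWithinAt
    · intro p hp
      exact hG' p.1 p.2 (hsph _ hp.1).1.le (hsph _ hp.2).2
  · intro w hw
    refine DifferentiableOn.diffContOnCl ?_
    rw [closure_ball _ hρ0.ne']
    refine DifferentiableOn.congr (f := fun s => w⁻¹ * F (s, w)) ?_ ?_
    · intro s hs
      have hs' : ‖s‖ ≤ ρ := by simpa using hs
      exact ((hA s w (hs'.trans_lt hρr) (by rw [(hsph w hw).1]; exact hρr)).fst_slice
        |>.differentiableAt.const_mul _).differentiableWithinAt
    · intro s hs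
      exact hG' s w (by simpa using hs) (hsph w hw).2
  · intro x hx
    have hx' : ‖x‖ < ρ := by simpa using hx
    refine DifferentiableOn.diffContOnCl ?_
    rw [closure_ball _ hρ0.ne']
    have hd : DifferentiableOn ℂ (fun y => F (x, y)) (ball 0 r) := fun y hy =>
      ((hA x y (hx'.trans hρr) (by simpa using hy)).snd_slice).differentiableAt
        |>.differentiableWithinAt
    exact ((differentiableOn_dslope (ball_mem_nhds 0 hr)).2 hd).mono (closedBall_subset_ball hρr)
  · exact eventually_nhds_prod_of_forall hρ0 fun x y hx _ => hG x y hx.le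

/-- An analytic function of two variables that vanishes on the graph `y = η(x)` is divisible by
`y - η(x)`. -/
theorem exists_eq_snd_sub_mul {F : ℂ × ℂ → ℂ} (hF : AnalyticAt ℂ F 0) {η : ℂ → ℂ}
    (hη : AnalyticAt ℂ η 0) (hη0 : η 0 = 0) (h0 : ∀ᶠ x in 𝓝 (0 : ℂ), F (x, η x) = 0) :
    ∃ G : ℂ × ℂ → ℂ, AnalyticAt ℂ G 0 ∧
      ∀ᶠ p in 𝓝 (0 : ℂ × ℂ), F p = (p.2 - η p.1) * G p := by
  have hη' : AnalyticAt ℂ (fun p : ℂ × ℂ => η p.1) 0 :=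
    AnalyticAt.comp_of_eq_apply hη analyticAt_fst rfl
  obtain ⟨G, hG, hFG⟩ := exists_eq_snd_mul (F := fun p => F (p.1, p.2 + η p.1))
    (hF.comp_prodMk analyticAt_fst (analyticAt_snd.add hη') rfl (by simp [hη0]))
    (by simpa using h0)
  have hs : AnalyticAt ℂ (fun p : ℂ × ℂ => p.2 - η p.1) 0 := analyticAt_snd.sub hη'
  refine ⟨fun p => G (p.1, p.2 - η p.1),
    hG.comp_prodMk analyticAt_fst hs rfl (by simp [hη0]), ?_⟩
  have ht : Tendsto (fun p : ℂ × ℂ => (p.1, p.2 - η p.1)) (𝓝 0) (𝓝 0) := by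
    have := (continuousAt_fst (p := (0 : ℂ × ℂ))).prodMk hs.continuousAt
    simpa [ContinuousAt, hη0, ← Prod.mk_zero_zero] using this
  filter_upwards [ht.eventually hFG] with p hp
  simpa using hp

/-- An analytic function that is invariant under the rotation `t ↦ ωt` of its first variable, for
a primitive `N`-th root of unity `ω`, is an analytic function of `(tᴺ, y)`. -/
theorem exists_eq_comp_pow {A : ℂ × ℂ → ℂ} (hA : AnalyticAt ℂ A 0) {N : ℕ} (hN : N ≠ 0) {ω : ℂ}
    (hω : IsPrimitiveRoot ω N) (hinv : ∀ᶠ p in 𝓝 (0 : ℂ × ℂ), A (ω * p.1, p.2) = A p) :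
    ∃ B : ℂ × ℂ → ℂ, AnalyticAt ℂ B 0 ∧ ∀ᶠ p in 𝓝 (0 : ℂ × ℂ), A p = B (p.1 ^ N, p.2) := by
  obtain ⟨R, hR, hAR⟩ := exists_forall_of_eventually_nhds_prod (hA.eventually_analyticAt.and hinv)
  have hωn : ‖ω‖ = 1 := hω.norm'_eq_one hN
  have hrot : ∀ (k : ℕ) (t y : ℂ), ‖t‖ < R → ‖y‖ < R → A (ω ^ k * t, y) = A (t, y) := by
    intro k t y ht hy
    induction k with
    | zero => simp
    | succ k ih =>
      rw [← ih, pow_succ', mul_assoc]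
      exact (hAR (ω ^ k * t) y (by simpa [hωn] using ht) hy).2
  let r : ℂ → ℂ := fun x => x ^ ((N : ℂ)⁻¹)
  have hr : ∀ x, r x ^ N = x := fun x => cpow_nat_inv_pow x hN
  have hrn : ∀ x, ‖r x‖ ^ N = ‖x‖ := fun x => by rw [← norm_pow, hr]
  have hrlt : ∀ x, ∀ s : ℝ, 0 ≤ s → ‖x‖ < s ^ N → ‖r x‖ < s := fun x s hs h =>
    lt_of_pow_lt_pow_left₀ N hs (by rwa [hrn])
  let B : ℂ × ℂ → ℂ := fun p => A (r p.1, p.2)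
  have hB : ∀ t y : ℂ, ‖t‖ < R → ‖y‖ < R → B (t ^ N, y) = A (t, y) := by
    intro t y ht hy
    rcases eq_or_ne t 0 with rfl | ht0
    · have : r 0 = 0 := pow_eq_zero_iff hN |>.1 (hr 0)
      simp [B, hN, this]
    · have h1 : (r (t ^ N) / t) ^ N = 1 := by
        rw [div_pow, hr, div_self (pow_ne_zero _ ht0)]
      have : NeZero N := ⟨hN⟩
      obtain ⟨k, -, hk⟩ := hω.eq_pow_of_pow_eq_one h1
      have h2 : r (t ^ N) = ω ^ k * t := by rw [hk, div_mul_cancel₀ _ ht0]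
      simp only [B, h2]
      exact hrot k t y ht hy
  -- away from `x = 0`, the function `B` is analytic because `t ↦ tᴺ` has local inverses
  have hBa : ∀ x y : ℂ, x ≠ 0 → ‖x‖ < R ^ N → ‖y‖ < R → AnalyticAt ℂ B (x, y) := by
    intro x y hx hxR hy
    have hpow : AnalyticAt ℂ (fun t : ℂ => t ^ N) (r x) := analyticAt_id.pow N
    have hrx : r x ≠ 0 := fun h => hx (by rw [← hr x, h, zero_pow hN])
    have hd : deriv (fun t : ℂ => t ^ N) (r x) ≠ 0 := by
      simp [hN, hrx]
    have hgl := hpow.analyticAt_localInverse hd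
    have hge := hpow.hasStrictDerivAt.eventually_right_inverse hd
    set g := hpow.hasStrictDerivAt.localInverse _ _ _ hd with hg
    have hg0 : g (r x ^ N) = r x := HasStrictFDerivAt.localInverse_apply_image ..
    simp only [hr] at hgl hge hg0
    have hg2 : AnalyticAt ℂ (fun p : ℂ × ℂ => g p.1) (x, y) :=
      AnalyticAt.comp_of_eq_apply hgl analyticAt_fst rfl
    have h3 : AnalyticAt ℂ (fun p : ℂ × ℂ => A (g p.1, p.2)) (x, y) :=
      (hAR (r x) y (hrlt x R hR.le hxR) hy).1.comp_prodMk hg2 analyticAt_snd (by simp [hg0]) rfl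
    refine h3.congr ?_
    have h4 : ∀ᶠ p : ℂ × ℂ in 𝓝 (x, y), g p.1 ^ N = p.1 :=
      (continuousAt_fst (p := (x, y))).eventually hge
    have h5 : ∀ᶠ p : ℂ × ℂ in 𝓝 (x, y), ‖g p.1‖ < R := by
      refine hg2.continuousAt.norm.eventually (eventually_lt_nhds ?_)
      simp only [hg0]
      exact hrlt x R hR.le hxR
    have h6 : ∀ᶠ p : ℂ × ℂ in 𝓝 (x, y), ‖p.2‖ < R :=
      (continuousAt_snd (p := (x, y))).norm.eventually (eventually_lt_nhds hy)
    filter_upwards [h4, h5, h6] with p h4 h5 h6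
    rw [← hB _ _ h5 h6, h4]
  have hB0 : ∀ y : ℂ, ‖y‖ < R → AnalyticAt ℂ (fun s => B (s, y)) 0 := by
    intro y hy
    refine analyticAt_of_differentiable_on_punctured_nhds_of_continuousAt ?_ ?_
    · have : ∀ᶠ z in 𝓝 (0 : ℂ), ‖z‖ < R ^ N := by
        filter_upwards [ball_mem_nhds (0 : ℂ) (pow_pos hR N)] with z hz
        simpa using hz
      filter_upwards [nhdsWithin_le_nhds this, self_mem_nhdsWithin] with z hz hz0
      exact (hBa z y hz0 hz hy).fst_slice.differentiableAt
    · have hrc : ContinuousAt r 0 := by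
        rw [Metric.continuousAt_iff]
        intro ε hε
        have hr0 : r 0 = 0 := pow_eq_zero_iff hN |>.1 (hr 0)
        refine ⟨ε ^ N, pow_pos hε N, fun {z} hz => ?_⟩
        rw [hr0, dist_zero_right]
        exact hrlt z ε hε.le (by simpa using hz)
      have hr0 : r 0 = 0 := pow_eq_zero_iff hN |>.1 (hr 0)
      have h7 : ContinuousAt (fun s => A (s, y)) (r 0) := by
        rw [hr0]
        exact (hAR 0 y (by simpa using hR) hy).1.fst_slice.continuousAt
      exact ContinuousAt.comp (g := fun s => A (s, y)) h7 hrc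
  obtain ⟨ρ, hρ0, hρ⟩ := exists_between (lt_min hR (pow_pos hR N))
  have hρR : ρ < R := hρ.trans_le (min_le_left _ _)
  have hρN : ρ < R ^ N := hρ.trans_le (min_le_right _ _)
  have hsph : ∀ w ∈ sphere (0 : ℂ) ρ, ‖w‖ = ρ ∧ w ≠ 0 := by
    intro w hw
    have : ‖w‖ = ρ := by simpa using hw
    exact ⟨this, norm_pos_iff.1 (by rw [this]; exact hρ0)⟩
  refine ⟨B, analyticAt_of_separately hρ0 ?_ ?_ ?_,
    eventually_nhds_prod_of_forall hR fun x y hx hy => (hB x y hx hy).symm⟩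
  · intro p hp
    have h1 := hsph _ hp.1
    have h2 := hsph _ hp.2
    exact (hBa p.1 p.2 h1.2 (by rw [h1.1]; exact hρN)
      (by rw [h2.1]; exact hρR)).continuousAt.continuousWithinAt
  · intro w hw
    refine DifferentiableOn.diffContOnCl fun s hs => ?_
    rw [closure_ball _ hρ0.ne'] at hs
    have hs' : ‖s‖ ≤ ρ := by simpa using hs
    have hw' : ‖w‖ < R := by rw [(hsph w hw).1]; exact hρR
    refine DifferentiableAt.differentiableWithinAt ?_
    rcases eq_or_ne s 0 with rfl | hs0
    · exact (hB0 w hw').differentiableAt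
    · exact (hBa s w hs0 (hs'.trans_lt hρN) hw').fst_slice.differentiableAt
  · intro x hx
    have hx' : ‖x‖ < ρ := by simpa using hx
    refine DifferentiableOn.diffContOnCl fun s hs => ?_
    rw [closure_ball _ hρ0.ne'] at hs
    have hs' : ‖s‖ ≤ ρ := by simpa using hs
    exact ((hAR (r x) s (hrlt x R hR.le (hx'.trans hρN)) (hs'.trans_lt hρR)).1.snd_slice
      |>.differentiableAt).differentiableWithinAt

/-! ### Newton–Puiseux roots -/

/-- Taylor expansion of order `n` in the second variable, with analytic coefficients. -/
theorem exists_eq_sum_add_snd_pow_mul {F : ℂ × ℂ → ℂ} (hF : AnalyticAt ℂ F 0) (n : ℕ) :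
    ∃ (a : ℕ → ℂ → ℂ) (u : ℂ × ℂ → ℂ), (∀ k, AnalyticAt ℂ (a k) 0) ∧ AnalyticAt ℂ u 0 ∧
      ∀ᶠ p in 𝓝 (0 : ℂ × ℂ), F p = ∑ k ∈ Finset.range n, a k p.1 * p.2 ^ k + p.2 ^ n * u p := by
  induction n with
  | zero => exact ⟨fun _ _ => 0, F, fun _ => analyticAt_const, hF, by simp⟩
  | succ n ih =>
    obtain ⟨a, u, ha, hu, h⟩ := ih
    have hb : AnalyticAt ℂ (fun x => u (x, 0)) 0 := AnalyticAt.fst_slice hu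
    have hb' : AnalyticAt ℂ (fun p : ℂ × ℂ => u (p.1, 0)) 0 :=
      AnalyticAt.comp_of_eq_apply (g := fun x => u (x, 0)) hb analyticAt_fst rfl
    obtain ⟨v, hv, huv⟩ := exists_eq_snd_mul (F := fun p => u p - u (p.1, 0)) (hu.sub hb')
      (by simp)
    refine ⟨fun k => if k = n then fun x => u (x, 0) else a k, v, fun k => ?_, hv, ?_⟩
    · dsimp only
      split_ifs
      exacts [hb, ha k]
    · filter_upwards [h, huv] with p hp hq
      rw [hp, Finset.sum_range_succ, if_pos rfl]
      have : ∑ k ∈ Finset.range n, (if k = n then fun x => u (x, 0) else a k) p.1 * p.2 ^ k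
          = ∑ k ∈ Finset.range n, a k p.1 * p.2 ^ k := by
        refine Finset.sum_congr rfl fun k hk => ?_
        rw [if_neg (Finset.mem_range.1 hk).ne]
      rw [this]
      linear_combination p.2 ^ n * hq

theorem iteratedDeriv_eq_of_eq_sum_add_pow_mul {f u : ℂ → ℂ} {n : ℕ} {a : ℕ → ℂ}
    (hu : AnalyticAt ℂ u 0)
    (h : ∀ᶠ y in 𝓝 (0 : ℂ), f y = ∑ k ∈ Finset.range n, a k * y ^ k + y ^ n * u y)
    {k : ℕ} (hk : k < n) : iteratedDeriv k f 0 = k.factorial * a k := by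
  have hs : AnalyticAt ℂ (fun y => ∑ k ∈ Finset.range n, a k * y ^ k) 0 :=
    Finset.analyticAt_fun_sum _ fun i _ => by fun_prop
  have hr : AnalyticAt ℂ (fun y => y ^ n * u y) 0 := by fun_prop
  have h0 : iteratedDeriv k (fun y => y ^ n * u y) 0 = 0 := by
    refine (natCast_le_analyticOrderAt_iff_iteratedDeriv_eq_zero hr (n := n)).1 ?_ k hk
    exact (natCast_le_analyticOrderAt hr).2 ⟨u, hu, by simp⟩
  rw [(EventuallyEq.iteratedDeriv_eq k h :), iteratedDeriv_fun_add hs.contDiffAt hr.contDiffAt, h0,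
    add_zero]
  simp (disch := fun_prop) only [iteratedDeriv_fun_sum, iteratedDeriv_const_mul,
      iteratedDeriv_fun_pow_zero]
  simp [hk, mul_comm]

/-- The iterated partial derivatives in the second variable are analytic. -/
theorem _root_.AnalyticAt.iteratedDeriv_snd {F : ℂ × ℂ → ℂ} {p : ℂ × ℂ} (hF : AnalyticAt ℂ F p)
    (k : ℕ) : AnalyticAt ℂ (fun q : ℂ × ℂ => iteratedDeriv k (fun y => F (q.1, y)) q.2) p := by
  induction k with
  | zero => simpa using hF
  | succ k ih =>
    have h1 : AnalyticAt ℂ (fun q : ℂ × ℂ => fderiv ℂ (fun q : ℂ × ℂ =>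
        iteratedDeriv k (fun y => F (q.1, y)) q.2) q (0, 1)) p :=
      AnalyticAt.fun_comp (g := ContinuousLinearMap.apply ℂ ℂ ((0 : ℂ), (1 : ℂ)))
        (ContinuousLinearMap.analyticAt _ _) ih.fderiv
    refine h1.congr ?_
    filter_upwards [ih.eventually_analyticAt] with q hq
    rw [iteratedDeriv_succ]
    have h2 : HasDerivAt (fun y : ℂ => (q.1, y)) (0, 1) q.2 :=
      (hasDerivAt_const _ _).prodMk (hasDerivAt_id _)
    exact (HasFDerivAt.comp_hasDerivAt (x := q.2)
      (l := fun q : ℂ × ℂ => iteratedDeriv k (fun y => F (q.1, y)) q.2)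
      hq.differentiableAt.hasFDerivAt h2).deriv.symm

/-- The analytic implicit function theorem, for a curve through the origin. -/
theorem exists_analyticAt_implicit {E : ℂ × ℂ → ℂ} (hE : AnalyticAt ℂ E 0) (h0 : E 0 = 0)
    (hd : deriv (fun y => E (0, y)) 0 ≠ 0) :
    ∃ η : ℂ → ℂ, AnalyticAt ℂ η 0 ∧ η 0 = 0 ∧ ∀ᶠ x in 𝓝 (0 : ℂ), E (x, η x) = 0 := by
  have hc : ContDiffAt ℂ ⊤ E (0 : ℂ × ℂ) := hE.contDiffAt
  have hinv : (fderiv ℂ E 0 ∘L .inr ℂ ℂ ℂ).IsInvertible := by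
    have h2 : HasDerivAt (fun y : ℂ => ((0 : ℂ), y)) (0, 1) 0 :=
      (hasDerivAt_const _ _).prodMk (hasDerivAt_id _)
    have h3 : deriv (fun y => E (0, y)) 0 = fderiv ℂ E 0 (0, 1) :=
      (HasFDerivAt.comp_hasDerivAt (x := (0 : ℂ)) (l := E)
      hE.differentiableAt.hasFDerivAt h2).deriv
    rw [h3] at hd
    refine ⟨ContinuousLinearEquiv.unitsEquivAut ℂ (Units.mk0 _ hd), ?_⟩
    ext
    simp
  refine ⟨hc.implicitFunction (by simp) hinv, ?_, hc.implicitFunction_apply_self (by simp) hinv, ?_⟩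
  · exact (hc.contDiffAt_implicitFunction (by simp) hinv).analyticAt
  · simpa [h0] using hc.eventually_apply_implicitFunction (by simp) hinv

/-- Tschirnhaus transformation: if `F(0, ·)` vanishes to order `n`, then after a translation
`y ↦ y + η(x)` the Taylor expansion of `F` in `y` has no term of degree `n - 1`. -/
theorem exists_tschirnhaus {F : ℂ × ℂ → ℂ} (hF : AnalyticAt ℂ F 0) {n : ℕ} (hn : n ≠ 0)
    (hord : analyticOrderAt (fun y => F (0, y)) 0 = n) :
    ∃ (η : ℂ → ℂ) (a : ℕ → ℂ → ℂ) (u : ℂ × ℂ → ℂ), AnalyticAt ℂ η 0 ∧ η 0 = 0 ∧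
      (∀ k, AnalyticAt ℂ (a k) 0) ∧ (∀ k < n, a k 0 = 0) ∧ (∀ᶠ x in 𝓝 (0 : ℂ), a (n - 1) x = 0) ∧
      AnalyticAt ℂ u 0 ∧ u 0 ≠ 0 ∧
      ∀ᶠ p in 𝓝 (0 : ℂ × ℂ), F (p.1, p.2 + η p.1)
        = ∑ k ∈ Finset.range n, a k p.1 * p.2 ^ k + p.2 ^ n * u p := by
  have hf : AnalyticAt ℂ (fun y => F (0, y)) 0 := AnalyticAt.snd_slice hF
  obtain ⟨hlow, htop⟩ := (analyticOrderAt_eq_nat_iff_iteratedDeriv_eq_zero hf).1 hord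
  obtain ⟨η, hη, hη0, hroot⟩ := exists_analyticAt_implicit (hF.iteratedDeriv_snd (n - 1))
    (hlow (n - 1) (by lia)) (by
      have := htop
      rw [← Nat.sub_one_add_one hn, iteratedDeriv_succ] at this
      exact this)
  have hη' : AnalyticAt ℂ (fun p : ℂ × ℂ => η p.1) 0 :=
    AnalyticAt.comp_of_eq_apply hη analyticAt_fst rfl
  obtain ⟨a, u, ha, hu, h⟩ := exists_eq_sum_add_snd_pow_mul (F := fun p => F (p.1, p.2 + η p.1))
    (hF.comp_prodMk analyticAt_fst (analyticAt_snd.add hη') rfl (by simp [hη0])) n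
  obtain ⟨r, hr, h'⟩ := exists_forall_of_eventually_nhds_prod (h.and hu.eventually_analyticAt)
  have hnear : ∀ᶠ x in 𝓝 (0 : ℂ), ‖x‖ < r := by
    filter_upwards [ball_mem_nhds (0 : ℂ) hr] with x hx
    simpa using hx
  have hslice : ∀ x : ℂ, ‖x‖ < r → ∀ k < n,
      iteratedDeriv k (fun y => F (x, y + η x)) 0 = k.factorial * a k x := by
    intro x hx k hk
    refine iteratedDeriv_eq_of_eq_sum_add_pow_mul (u := fun y => u (x, y)) (a := fun k => a k x)
      (h' x 0 hx (by simpa using hr)).2.snd_slice ?_ hk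
    filter_upwards [hnear] with y hy
    exact (h' x y hx hy).1
  have ha0 : ∀ k < n, a k 0 = 0 := by
    intro k hk
    have := hslice 0 (by simpa using hr) k hk
    simp only [hη0, add_zero, hlow k hk] at this
    simpa [Nat.factorial_ne_zero] using this.symm
  refine ⟨η, a, u, hη, hη0, ha, ha0, ?_, hu, ?_, h⟩
  · filter_upwards [hnear, hroot] with x hx hx0
    have := hslice x hx (n - 1) (by lia)
    rw [iteratedDeriv_comp_add_const (f := fun y => F (x, y))] at this
    simp only [zero_add, hx0] at this
    simpa [Nat.factorial_ne_zero] using this.symm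
  · have hu' : AnalyticAt ℂ (fun y => u (0, y)) 0 := AnalyticAt.snd_slice hu
    have h1 : (fun y => F (0, y)) =ᶠ[𝓝 0] (fun y => y ^ n) * (fun y => u (0, y)) := by
      filter_upwards [hnear] with y hy
      have := (h' 0 y (by simpa using hr) hy).1
      simp only [hη0, add_zero] at this
      rw [this, Finset.sum_eq_zero, zero_add]
      · rfl
      · intro k hk
        rw [ha0 k (Finset.mem_range.1 hk), zero_mul]
    have h2 : analyticOrderAt (fun y : ℂ => y ^ n) 0 = n := by
      have := analyticOrderAt_centeredMonomial (𝕜 := ℂ) (z₀ := 0) (n := n)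
      simp only [sub_zero] at this
      exact this
    rw [analyticOrderAt_congr h1, analyticOrderAt_mul (by fun_prop) hu', h2] at hord
    have h3 : analyticOrderAt (fun y => u (0, y)) 0 = 0 := by
      cases h4 : analyticOrderAt (fun y => u (0, y)) 0 with
      | top => simp [h4] at hord
      | coe m =>
        rw [h4] at hord
        norm_cast at hord ⊢
        lia
    exact hu'.analyticOrderAt_eq_zero.1 h3

/-- The first side of the Newton polygon: analytic coefficients `a₀, …, aₙ₋₁` vanishing at `0` and
not all zero admit a slope `p / q` such that `aₖ(t^q)` is divisible by `t^(p(n-k))` for all `k`,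
the quotient being nonzero at `0` for at least one `k`. -/
theorem exists_newton_slope {n : ℕ} {a : ℕ → ℂ → ℂ} (ha : ∀ k, AnalyticAt ℂ (a k) 0)
    (ha0 : ∀ k < n, a k 0 = 0) (hne : ¬ ∀ k < n, ∀ᶠ x in 𝓝 (0 : ℂ), a k x = 0) :
    ∃ (p q : ℕ) (b : ℕ → ℂ → ℂ), p ≠ 0 ∧ q ≠ 0 ∧ (∀ k, AnalyticAt ℂ (b k) 0) ∧
      (∀ k < n, ∀ᶠ t in 𝓝 (0 : ℂ), a k (t ^ q) = t ^ (p * (n - k)) * b k t) ∧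
      (∀ k < n, (∀ᶠ x in 𝓝 (0 : ℂ), a k x = 0) → b k 0 = 0) ∧ ∃ k < n, b k 0 ≠ 0 := by
  classical
  let o : ℕ → ℕ := fun k => analyticOrderNatAt (a k) 0
  have hg : ∀ k, ∃ g : ℂ → ℂ, AnalyticAt ℂ g 0 ∧ (∀ᶠ x in 𝓝 (0 : ℂ), a k x = x ^ o k * g x) ∧
      ((¬ ∀ᶠ x in 𝓝 (0 : ℂ), a k x = 0) → g 0 ≠ 0) ∧
      ((∀ᶠ x in 𝓝 (0 : ℂ), a k x = 0) → ∀ x, g x = 0) := by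
    intro k
    by_cases hk : ∀ᶠ x in 𝓝 (0 : ℂ), a k x = 0
    · exact ⟨fun _ => 0, analyticAt_const, by simpa using hk, fun h => absurd hk h, fun _ _ => rfl⟩
    · have ht : analyticOrderAt (a k) 0 ≠ ⊤ := fun h => hk (analyticOrderAt_eq_top.1 h)
      obtain ⟨g, hg, hg0, h⟩ := (ha k).analyticOrderNatAt_eq_iff ht |>.1 (rfl : _ = o k)
      exact ⟨g, hg, by simpa using h, fun _ => hg0, fun h => absurd h hk⟩
  choose g hg hag hg0 hgz using hg
  let S := (Finset.range n).filter fun k => ¬ ∀ᶠ x in 𝓝 (0 : ℂ), a k x = 0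
  have hS : S.Nonempty := by
    by_contra hS
    rw [Finset.not_nonempty_iff_eq_empty] at hS
    refine hne fun k hk => by_contra fun h => ?_
    have : k ∈ S := Finset.mem_filter.2 ⟨Finset.mem_range.2 hk, h⟩
    rw [hS] at this
    simp at this
  obtain ⟨k₀, hk₀, hmin⟩ := S.exists_min_image (fun k => (o k : ℚ) / ((n - k : ℕ) : ℚ)) hS
  obtain ⟨hk₀n, hk₀z⟩ := Finset.mem_filter.1 hk₀
  rw [Finset.mem_range] at hk₀n
  have hq : n - k₀ ≠ 0 := by lia
  have hslope : ∀ k ∈ S, o k₀ * (n - k) ≤ (n - k₀) * o k := by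
    intro k hk
    have h1 := hmin k hk
    have hkn : k < n := Finset.mem_range.1 (Finset.mem_filter.1 hk).1
    have h2 : (0 : ℚ) < ((n - k : ℕ) : ℚ) := by exact_mod_cast (by lia : 0 < n - k)
    have h3 : (0 : ℚ) < ((n - k₀ : ℕ) : ℚ) := by exact_mod_cast (by lia : 0 < n - k₀)
    rw [div_le_div_iff₀ h3 h2] at h1
    have h4 : o k₀ * (n - k) ≤ o k * (n - k₀) := by exact_mod_cast h1
    linarith [mul_comm (o k) (n - k₀)]
  have hp : o k₀ ≠ 0 := by
    intro h
    have h1 := (hag k₀).self_of_nhds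
    rw [h, ha0 k₀ hk₀n, pow_zero, one_mul] at h1
    exact hg0 k₀ hk₀z h1.symm
  have hpow : Tendsto (fun t : ℂ => t ^ (n - k₀)) (𝓝 0) (𝓝 0) := by
    have : ContinuousAt (fun t : ℂ => t ^ (n - k₀)) 0 := by fun_prop
    simpa [ContinuousAt, hq] using this
  refine ⟨o k₀, n - k₀, fun k t => t ^ ((n - k₀) * o k - o k₀ * (n - k)) * g k (t ^ (n - k₀)),
    hp, hq, fun k => ?_, fun k hk => ?_, fun k hk h => ?_, k₀, hk₀n, ?_⟩
  · exact (analyticAt_id.pow _).mul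
      (AnalyticAt.comp_of_eq_apply (hg k) (analyticAt_id.pow _) (by simp [hq]))
  · filter_upwards [hpow.eventually (hag k)] with t ht
    rw [ht]
    by_cases hkz : ∀ᶠ x in 𝓝 (0 : ℂ), a k x = 0
    · simp [hgz k hkz]
    · have hkS : k ∈ S := Finset.mem_filter.2 ⟨Finset.mem_range.2 hk, hkz⟩
      rw [← mul_assoc, ← pow_mul, ← pow_add, Nat.add_sub_cancel' (hslope k hkS)]
  · simp [hgz k h]
  · simp only [mul_comm, Nat.sub_self, pow_zero]
    simpa [hq] using hg0 k₀ hk₀z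

/-- A complex polynomial of degree `n` without term of degree `n - 1` that is not a monomial has a
root of multiplicity at least `1` and less than `n`. -/
theorem exists_root_of_multiplicity_lt {n : ℕ} {c : ℕ → ℂ} {d : ℂ} (hd : d ≠ 0)
    (hlast : c (n - 1) = 0) (hne : ∃ k < n, c k ≠ 0) :
    ∃ (z₀ : ℂ) (m : ℕ), m ≠ 0 ∧ m < n ∧
      analyticOrderAt (fun z => ∑ k ∈ Finset.range n, c k * (z₀ + z) ^ k + (z₀ + z) ^ n * d) 0
        = m := by
  open Polynomial in
  obtain ⟨k₀, hk₀, hck₀⟩ := hne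
  let P : ℂ[X] := ∑ k ∈ Finset.range n, C (c k) * X ^ k + X ^ n * C d
  have hcoeff : ∀ k, P.coeff k = (if k < n then c k else 0) + if k = n then d else 0 := by
    intro k
    simp only [P, coeff_add, finsetSum_coeff, coeff_C_mul, coeff_X_pow, coeff_mul_C]
    congr 1
    · simp
    · simp
  have heval : ∀ z, P.eval z = ∑ k ∈ Finset.range n, c k * z ^ k + z ^ n * d := by
    intro z
    simp [P, eval_finsetSum, mul_comm d]
  have hnat : P.natDegree = n := by
    refine natDegree_eq_of_le_of_coeff_ne_zero ?_ (by simp [hcoeff, hd])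
    rw [natDegree_le_iff_coeff_eq_zero]
    intro k hk
    rw [hcoeff, if_neg (by lia), if_neg (by lia), add_zero]
  have hP0 : P ≠ 0 := fun h => hck₀ (by
    have := hcoeff k₀
    rw [if_pos hk₀, if_neg hk₀.ne, add_zero, h, coeff_zero] at this
    exact this.symm)
  obtain ⟨z₀, hz₀⟩ := IsAlgClosed.exists_root P (by
    rw [degree_eq_natDegree hP0, hnat]
    exact_mod_cast (by lia : n ≠ 0))
  obtain ⟨h, hPh, hh⟩ := P.exists_eq_pow_rootMultiplicity_mul_and_not_dvd hP0 z₀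
  set m := P.rootMultiplicity z₀ with hm
  have hh0 : h ≠ 0 := fun h0 => by simp [h0] at hh
  have hdeg : m + h.natDegree = n := by
    have := congrArg natDegree hPh
    rw [hnat, natDegree_mul (pow_ne_zero _ (X_sub_C_ne_zero _)) hh0, natDegree_pow,
      natDegree_X_sub_C, mul_one] at this
    exact this.symm
  refine ⟨z₀, m, ?_, ?_, ?_⟩
  · exact ((rootMultiplicity_pos hP0).2 hz₀).ne'
  · refine lt_of_le_of_ne (by lia) fun hmn => ?_
    obtain ⟨e, he⟩ := natDegree_eq_zero.1 (by lia : h.natDegree = 0)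
    rw [hmn, ← he] at hPh
    have he0 : e ≠ 0 := fun h0 => hh0 (by rw [← he, h0, C_0])
    -- comparing coefficients of degree `n - 1` shows that the root is `0`
    have h1 := hcoeff (n - 1)
    rw [if_pos (by lia), if_neg (by lia), hlast, add_zero, hPh, coeff_mul_C,
      sub_eq_add_neg, ← C_neg, coeff_X_add_C_pow, show n - (n - 1) = 1 by lia, Nat.choose_symm_of_eq_add
        (show n = (n - 1) + 1 by lia), Nat.choose_one_right] at h1
    have hn0 : (n : ℂ) ≠ 0 := by exact_mod_cast (by lia : n ≠ 0)
    have hz : z₀ = 0 := by simpa [he0, hn0] using h1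
    have h2 := hcoeff k₀
    rw [if_pos hk₀, if_neg hk₀.ne, add_zero, hPh, hz, C_0, sub_zero, coeff_mul_C, coeff_X_pow,
      if_neg hk₀.ne, zero_mul] at h2
    exact hck₀ h2.symm
  · have hfun : (fun z => ∑ k ∈ Finset.range n, c k * (z₀ + z) ^ k + (z₀ + z) ^ n * d)
        = fun z => P.eval (z₀ + z) := by
      funext z
      rw [heval]
    have ha : ∀ Q : ℂ[X], AnalyticAt ℂ (fun z => Q.eval (z₀ + z)) 0 := fun Q =>
      (by fun_prop : Differentiable ℂ fun z => Q.eval (z₀ + z)).analyticAt 0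
    rw [hfun, (ha P).analyticOrderAt_eq_natCast]
    refine ⟨fun z => h.eval (z₀ + z), ha h, ?_, Eventually.of_forall fun z => ?_⟩
    · simp only [add_zero]
      exact fun h0 => hh (dvd_iff_isRoot.2 h0)
    · conv_lhs => rw [hPh]
      simp

/-- **Newton–Puiseux**: if `F(0, ·)` vanishes to finite order `n ≥ 1` at `0`, then `F(tᴺ, y) = 0` has
an analytic solution `y(t)` with `y(0) = 0`. The order drops in each step, since the Tschirnhaus
transformation keeps the reduced equation from having an `n`-fold root. -/
theorem exists_puiseux_root (n : ℕ) (hn : n ≠ 0) (F : ℂ × ℂ → ℂ) (hF : AnalyticAt ℂ F 0)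
    (hord : analyticOrderAt (fun y => F (0, y)) 0 = n) :
    ∃ (N : ℕ) (y : ℂ → ℂ), N ≠ 0 ∧ AnalyticAt ℂ y 0 ∧ y 0 = 0 ∧
      ∀ᶠ t in 𝓝 (0 : ℂ), F (t ^ N, y t) = 0 := by
  induction n using Nat.strong_induction_on generalizing F with
  | _ n ih =>
  obtain ⟨η, a, u, hη, hη0, ha, ha0, hlast, hu, hu0, h⟩ := exists_tschirnhaus hF hn hord
  by_cases hne : ∀ k < n, ∀ᶠ x in 𝓝 (0 : ℂ), a k x = 0
  · refine ⟨1, η, one_ne_zero, hη, hη0, ?_⟩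
    have hc : Tendsto (fun x : ℂ => (x, (0 : ℂ))) (𝓝 0) (𝓝 0) := by
      have : ContinuousAt (fun x : ℂ => (x, (0 : ℂ))) 0 := by fun_prop
      exact this
    have hall : ∀ᶠ x in 𝓝 (0 : ℂ), ∀ k ∈ Finset.range n, a k x = 0 :=
      (Filter.eventually_all_finset _).2 fun k hk => hne k (Finset.mem_range.1 hk)
    filter_upwards [hc.eventually h, hall] with x hx hx'
    simp only [zero_add, zero_pow hn, zero_mul, add_zero] at hx
    rw [pow_one, hx]
    exact Finset.sum_eq_zero fun k hk => by rw [hx' k hk, zero_mul]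
  · obtain ⟨p, q, b, hp, hq, hb, hab, hbz, hbne⟩ := exists_newton_slope ha ha0 hne
    obtain ⟨z₀, m, hm0, hmn, hm⟩ := exists_root_of_multiplicity_lt (c := fun k => b k 0) hu0
      (hbz _ (by lia) hlast) hbne
    let G : ℂ × ℂ → ℂ := fun s => ∑ k ∈ Finset.range n, b k s.1 * (z₀ + s.2) ^ k
      + (z₀ + s.2) ^ n * u (s.1 ^ q, s.1 ^ p * (z₀ + s.2))
    have hG : AnalyticAt ℂ G 0 := by
      have hz : AnalyticAt ℂ (fun s : ℂ × ℂ => z₀ + s.2) 0 := analyticAt_const.add analyticAt_snd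
      refine AnalyticAt.add (Finset.analyticAt_fun_sum _ fun k _ => ?_) ?_
      · exact (AnalyticAt.comp_of_eq_apply (hb k) analyticAt_fst rfl).mul (hz.pow k)
      · exact (hz.pow n).mul (hu.comp_prodMk (analyticAt_fst.pow q)
          ((analyticAt_fst.pow p).mul hz) (by simp [hq]) (by simp [hp]))
    obtain ⟨N, z, hN, hz, hz0, hroot⟩ := ih m hmn hm0 G hG (by
      rw [← hm]
      congr 1
      funext w
      simp [G, hp, hq, Prod.mk_zero_zero])
    have hηq : AnalyticAt ℂ (fun s : ℂ => η ((s ^ N) ^ q)) 0 :=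
      AnalyticAt.comp_of_eq_apply hη ((analyticAt_id.pow N).pow q) (by simp [hN, hq])
    have hy : AnalyticAt ℂ (fun s : ℂ => (s ^ N) ^ p * (z₀ + z s)) 0 :=
      ((analyticAt_id.pow N).pow p).mul (analyticAt_const.add hz)
    refine ⟨N * q, fun s => (s ^ N) ^ p * (z₀ + z s) + η ((s ^ N) ^ q), mul_ne_zero hN hq,
      hy.add hηq, by simp [hN, hp, hq, hη0], ?_⟩
    have hall : ∀ᶠ t in 𝓝 (0 : ℂ), ∀ k ∈ Finset.range n,
        a k (t ^ q) = t ^ (p * (n - k)) * b k t :=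
      (Filter.eventually_all_finset _).2 fun k hk => hab k (Finset.mem_range.1 hk)
    have hc1 : Tendsto (fun s : ℂ => s ^ N) (𝓝 0) (𝓝 0) := by
      have : ContinuousAt (fun s : ℂ => s ^ N) 0 := by fun_prop
      simpa [ContinuousAt, hN] using this
    have hc2 : Tendsto (fun s : ℂ => ((s ^ N) ^ q, (s ^ N) ^ p * (z₀ + z s))) (𝓝 0) (𝓝 0) := by
      have : ContinuousAt (fun s : ℂ => ((s ^ N) ^ q, (s ^ N) ^ p * (z₀ + z s))) 0 :=
        ContinuousAt.prodMk (by fun_prop) hy.continuousAt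
      simpa [ContinuousAt, hN, hp, hq, ← Prod.mk_zero_zero] using this
    filter_upwards [hroot, hc1.eventually hall, hc2.eventually h] with s h1 h2 h3
    simp only [G] at h1
    rw [pow_mul, h3]
    -- the weighted substitution makes `t ^ (p * n)` a common factor
    rw [← mul_zero ((s ^ N) ^ (p * n)), ← h1, mul_add ((s ^ N) ^ (p * n)), Finset.mul_sum]
    congr 1
    · refine Finset.sum_congr rfl fun k hk => ?_
      have hkn := Finset.mem_range.1 hk
      rw [h2 k hk, mul_pow, ← pow_mul (s ^ N) p k]
      have : p * n = p * (n - k) + p * k := by rw [← mul_add, Nat.sub_add_cancel hkn.le]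
      rw [this, pow_add]
      ring
    · rw [mul_pow, ← pow_mul]
      ring

/-! ### Parametrization of branches -/

theorem eventually_forall_pow_eq (N : ℕ) {P : ℂ × ℂ → Prop}
    (h : ∀ᶠ p in 𝓝 (0 : ℂ × ℂ), P p) :
    ∀ᶠ p in 𝓝 (0 : ℂ × ℂ), ∀ t : ℂ, t ^ N = p.1 → P (t, p.2) := by
  obtain ⟨r, hr, h⟩ := exists_forall_of_eventually_nhds_prod h
  refine eventually_nhds_prod_of_forall (lt_min hr (pow_pos hr N)) fun x y hx hy t ht => ?_
  refine h t y (lt_of_pow_lt_pow_left₀ N hr.le ?_) (hy.trans_le (min_le_left _ _))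
  rw [← norm_pow]
  simp only at ht
  rw [ht]
  exact hx.trans_le (min_le_right _ _)

theorem eventually_nhdsNE_forall_ne {d : ℕ} (c : ℕ → ℂ) (y₀ : ℂ) :
    ∀ᶠ y in 𝓝[≠] y₀, ∀ k ∈ Finset.range d, y ≠ c k := by
  refine (Filter.eventually_all_finset _).2 fun k _ => ?_
  rcases eq_or_ne y₀ (c k) with h | h
  · rw [← h]
    exact self_mem_nhdsWithin
  · exact nhdsWithin_le_nhds (eventually_ne_nhds h)

/-- Division by the product of the `y - yₖ(t)`, for roots `yₖ` with pairwise distinct germs. -/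
theorem exists_eq_prod_mul {A : ℂ × ℂ → ℂ} (hA : AnalyticAt ℂ A 0) {y : ℕ → ℂ → ℂ}
    (hy : ∀ k, AnalyticAt ℂ (y k) 0) (hy0 : ∀ k, y k 0 = 0)
    (hroot : ∀ k, ∀ᶠ t in 𝓝 (0 : ℂ), A (t, y k t) = 0) {d : ℕ}
    (hdist : ∀ j < d, ∀ k < j, ¬ ∀ᶠ t in 𝓝 (0 : ℂ), y j t = y k t) :
    ∃ H : ℂ × ℂ → ℂ, AnalyticAt ℂ H 0 ∧
      ∀ᶠ p in 𝓝 (0 : ℂ × ℂ), A p = (∏ k ∈ Finset.range d, (p.2 - y k p.1)) * H p := by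
  induction d with
  | zero => exact ⟨A, hA, by simp⟩
  | succ d ih =>
    obtain ⟨H, hH, hAH⟩ := ih fun j hj => hdist j (by lia)
    have hcurve : AnalyticAt ℂ (fun t : ℂ => H (t, y d t)) 0 :=
      hH.comp_prodMk analyticAt_id (hy d) rfl (hy0 d)
    have hc : Tendsto (fun t : ℂ => (t, y d t)) (𝓝 0) (𝓝 0) := by
      have : ContinuousAt (fun t : ℂ => (t, y d t)) 0 :=
        continuousAt_id.prodMk (hy d).continuousAt
      simpa [ContinuousAt, hy0, ← Prod.mk_zero_zero] using this
    have hne : ∀ᶠ t in 𝓝[≠] (0 : ℂ), ∀ k ∈ Finset.range d, y d t ≠ y k t := by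
      refine (Filter.eventually_all_finset _).2 fun k hk => ?_
      exact ((hy d).eventually_eq_or_eventually_ne (hy k)).resolve_left
        (hdist d (by lia) k (Finset.mem_range.1 hk))
    have hz : ∀ᶠ t in 𝓝[≠] (0 : ℂ), H (t, y d t) = 0 := by
      filter_upwards [hne, nhdsWithin_le_nhds (hc.eventually hAH),
        nhdsWithin_le_nhds (hroot d)] with t h1 h2 h3
      rw [h3] at h2
      refine (mul_eq_zero.1 h2.symm).resolve_left (Finset.prod_ne_zero_iff.2 fun k hk => ?_)
      exact sub_ne_zero.2 (h1 k hk)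
    have hz' : ∀ᶠ t in 𝓝 (0 : ℂ), H (t, y d t) = 0 :=
      hcurve.frequently_zero_iff_eventually_zero.1 hz.frequently
    obtain ⟨H', hH', hHH'⟩ := exists_eq_snd_sub_mul hH (hy d) (hy0 d) hz'
    refine ⟨H', hH', ?_⟩
    filter_upwards [hAH, hHH'] with p h1 h2
    rw [Finset.prod_range_succ, h1, h2, mul_assoc]

/-- The zero set of an irreducible germ that does not vanish identically on `x = 0` is parametrized
by `t ↦ (tᴺ, y(t))`. The product `Q` of `y - y(ωᵏt)` over the distinct rotations of a Puiseux root
divides `F(tᴺ, y)`; `Q` and the cofactor are invariant under rotations, so they descend to a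
factorization of `F`, in which the cofactor must be a unit. -/
theorem exists_parametrization {F : ℂ × ℂ → ℂ} (hF : AnalyticAt ℂ F 0) (hF0 : F 0 = 0)
    (hirr : ∀ G H : ℂ × ℂ → ℂ, AnalyticAt ℂ G 0 → AnalyticAt ℂ H 0 →
      (∀ᶠ p in 𝓝 0, F p = G p * H p) → G 0 ≠ 0 ∨ H 0 ≠ 0)
    (hreg : ¬ ∀ᶠ y in 𝓝 (0 : ℂ), F (0, y) = 0) :
    ∃ (N : ℕ) (y : ℂ → ℂ), N ≠ 0 ∧ AnalyticAt ℂ y 0 ∧ y 0 = 0 ∧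
      ∀ᶠ p in 𝓝 (0 : ℂ × ℂ), F p = 0 ↔ ∃ t, t ^ N = p.1 ∧ y t = p.2 := by
  classical
  have hf : AnalyticAt ℂ (fun y => F (0, y)) 0 := AnalyticAt.snd_slice hF
  have htop : analyticOrderAt (fun y => F (0, y)) 0 ≠ ⊤ := fun h =>
    hreg (analyticOrderAt_eq_top.1 h)
  obtain ⟨n, hn⟩ := ENat.ne_top_iff_exists.1 htop
  have hn0 : n ≠ 0 := by
    rintro rfl
    exact hf.analyticOrderAt_eq_zero.1 hn.symm hF0
  obtain ⟨N, y, hN, hy, hy0, hroot⟩ := exists_puiseux_root n hn0 F hF hn.symm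
  refine ⟨N, y, hN, hy, hy0, ?_⟩
  obtain ⟨ω, hω⟩ : ∃ ω : ℂ, IsPrimitiveRoot ω N := ⟨_, isPrimitiveRoot_exp N hN⟩
  have hω1 : ω ^ N = 1 := hω.pow_eq_one
  have hωk : ∀ k : ℕ, (ω ^ k) ^ N = 1 := fun k => by rw [← pow_mul, mul_comm, pow_mul, hω1, one_pow]
  have hω0 : ω ≠ 0 := hω.ne_zero hN
  have hmul : ∀ c : ℂ, Tendsto (fun t : ℂ => c * t) (𝓝 0) (𝓝 0) := fun c => by
    have : ContinuousAt (fun t : ℂ => c * t) 0 := by fun_prop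
    simpa [ContinuousAt] using this
  -- the distinct rotations of the root
  let Y : ℕ → ℂ → ℂ := fun k t => y (ω ^ k * t)
  have hYa : ∀ k, AnalyticAt ℂ (Y k) 0 := fun k =>
    AnalyticAt.comp_of_eq_apply hy (analyticAt_const.mul analyticAt_id) (by simp)
  have hY0 : ∀ k, Y k 0 = 0 := fun k => by simp [Y, hy0]
  have hex : ∃ d, d ≠ 0 ∧ ∀ᶠ t in 𝓝 (0 : ℂ), Y d t = y t :=
    ⟨N, hN, Eventually.of_forall fun t => by simp [Y, hω1]⟩
  let d := Nat.find hex
  obtain ⟨hd0, hdper⟩ : d ≠ 0 ∧ ∀ᶠ t in 𝓝 (0 : ℂ), Y d t = y t := Nat.find_spec hex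
  have hdmin : ∀ e < d, e ≠ 0 → ¬ ∀ᶠ t in 𝓝 (0 : ℂ), Y e t = y t := fun e he he0 h =>
    Nat.find_min hex he ⟨he0, h⟩
  have hdist : ∀ j < d, ∀ k < j, ¬ ∀ᶠ t in 𝓝 (0 : ℂ), Y j t = Y k t := by
    intro j hj k hk h
    refine hdmin (j - k) (by lia) (by lia) ?_
    filter_upwards [(hmul (ω ^ k)⁻¹).eventually h] with t ht
    simp only [Y] at ht ⊢
    rw [mul_inv_cancel_left₀ (pow_ne_zero _ hω0), ← mul_assoc, ← pow_sub₀ ω hω0 hk.le] at ht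
    exact ht
  have hA : AnalyticAt ℂ (fun p : ℂ × ℂ => F (p.1 ^ N, p.2)) 0 :=
    hF.comp_prodMk (analyticAt_fst.pow N) analyticAt_snd (by simp [hN]) rfl
  obtain ⟨H, hH, hAH⟩ := exists_eq_prod_mul hA hYa hY0 (d := d) (fun k => by
    filter_upwards [(hmul (ω ^ k)).eventually hroot] with t ht
    simpa [Y, mul_pow, hωk] using ht) hdist
  let Q : ℂ × ℂ → ℂ := fun p => ∏ k ∈ Finset.range d, (p.2 - Y k p.1)
  have hQ : AnalyticAt ℂ Q 0 := Finset.analyticAt_fun_prod _ fun k _ =>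
    analyticAt_snd.sub (AnalyticAt.comp_of_eq_apply (hYa k) analyticAt_fst rfl)
  have hQinv : ∀ᶠ p in 𝓝 (0 : ℂ × ℂ), Q (ω * p.1, p.2) = Q p := by
    filter_upwards [(continuousAt_fst (p := (0 : ℂ × ℂ))).eventually hdper] with p hp
    have hshift : ∀ k, Y k (ω * p.1) = Y (k + 1) p.1 := fun k => by
      simp only [Y, pow_succ, mul_assoc]
    obtain ⟨e, he⟩ := Nat.exists_eq_succ_of_ne_zero hd0
    simp only [Q, hshift]
    rw [he] at hp ⊢
    rw [Finset.prod_range_succ, Finset.prod_range_succ']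
    have hY00 : Y 0 p.1 = y p.1 := by simp [Y]
    rw [hY00, ← hp]
  have hHinv : ∀ᶠ p in 𝓝 (0 : ℂ × ℂ), H (ω * p.1, p.2) = H p := by
    obtain ⟨r, hr, h⟩ := exists_forall_of_eventually_nhds_prod
      ((hAH.and hQinv).and hH.eventually_analyticAt)
    have hωn : ‖ω‖ = 1 := hω.norm'_eq_one hN
    refine eventually_nhds_prod_of_forall hr fun t z ht hz => ?_
    have ht' : ‖ω * t‖ < r := by rwa [norm_mul, hωn, one_mul]
    have hD : AnalyticAt ℂ (fun w => H (ω * t, w) - H (t, w)) z :=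
      (h _ _ ht' hz).2.snd_slice.sub (h _ _ ht hz).2.snd_slice
    have hzero : ∀ᶠ w in 𝓝[≠] z, H (ω * t, w) - H (t, w) = 0 := by
      have hlt : ∀ᶠ w in 𝓝 z, ‖w‖ < r := continuous_norm.continuousAt.eventually
        (eventually_lt_nhds hz)
      filter_upwards [eventually_nhdsNE_forall_ne (d := d) (fun k => Y k t) z,
        nhdsWithin_le_nhds hlt] with w hw hwr
      have h1 := (h _ _ ht' hwr).1.1
      have h2 := (h _ _ ht hwr).1.1
      have h3 := (h _ _ ht hwr).1.2
      have h4 : Q (t, w) ≠ 0 := Finset.prod_ne_zero_iff.2 fun k hk => sub_ne_zero.2 (hw k hk)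
      simp only [mul_pow, hω1, one_mul] at h1 h2
      rw [h2] at h1
      change Q (t, w) * H (t, w) = Q (ω * t, w) * H (ω * t, w) at h1
      rw [h3] at h1
      exact sub_eq_zero.2 (mul_left_cancel₀ h4 h1).symm
    exact sub_eq_zero.1 (hD.frequently_zero_iff_eventually_zero.1 hzero.frequently).self_of_nhds
  obtain ⟨Q', hQ', hQQ'⟩ := exists_eq_comp_pow hQ hN hω hQinv
  obtain ⟨H', hH', hHH'⟩ := exists_eq_comp_pow hH hN hω hHinv
  have hrt : ∀ x : ℂ, ∃ t : ℂ, t ^ N = x := fun x => ⟨_, cpow_nat_inv_pow x hN⟩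
  have hfac : ∀ᶠ p in 𝓝 (0 : ℂ × ℂ), F p = Q' p * H' p := by
    filter_upwards [eventually_forall_pow_eq N (hAH.and (hQQ'.and hHH'))] with p hp
    obtain ⟨t, ht⟩ := hrt p.1
    obtain ⟨h1, h2, h3⟩ := hp t ht
    simp only [ht] at h1 h2 h3
    rw [← h2, ← h3]
    exact h1
  have hQ'0 : Q' 0 = 0 := by
    have h1 := hQQ'.self_of_nhds
    simp only [Prod.fst_zero, Prod.snd_zero, zero_pow hN, Prod.mk_zero_zero] at h1
    rw [← h1]
    exact Finset.prod_eq_zero (Finset.mem_range.2 (Nat.pos_of_ne_zero hd0)) (by simp [hY0])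
  have hH'0 : H' 0 ≠ 0 := (hirr Q' H' hQ' hH' hfac).resolve_left fun h => h hQ'0
  filter_upwards [hfac, hH'.continuousAt.eventually_ne hH'0,
    eventually_forall_pow_eq N (hQQ'.and ((continuousAt_fst (p := (0 : ℂ × ℂ))).eventually hroot))]
    with p h1 h2 h3
  constructor
  · intro hp
    obtain ⟨t, ht⟩ := hrt p.1
    have h4 := (h3 t ht).1
    simp only [ht] at h4
    rw [h1] at hp
    have h5 : Q (t, p.2) = 0 := by
      rw [h4]
      exact (mul_eq_zero.1 hp).resolve_right h2
    obtain ⟨k, -, hk⟩ := Finset.prod_eq_zero_iff.1 h5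
    exact ⟨ω ^ k * t, by rw [mul_pow, hωk, one_mul, ht], (sub_eq_zero.1 hk).symm⟩
  · rintro ⟨t, ht, hyt⟩
    have h4 := (h3 t ht).2
    simpa [ht, hyt] using h4

/-- The set `C` is, near `0` and in the linear coordinates `(x, y)` given by `E`, the image of the
analytic curve `t ↦ (tᴺ, y(t))` through the origin. -/
structure IsParametrized (C : Set Plane) (E : (ℂ × ℂ) ≃L[ℂ] Plane) (N : ℕ) (y : ℂ → ℂ) : Prop where
  ne_zero : N ≠ 0
  analyticAt : AnalyticAt ℂ y 0
  apply_zero : y 0 = 0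
  mem_iff : ∀ᶠ p in 𝓝 (0 : ℂ × ℂ), E p ∈ C ↔ ∃ t, t ^ N = p.1 ∧ y t = p.2

theorem tendsto_equiv_zero {V W : Type*} [NormedAddCommGroup V] [NormedSpace ℂ V]
    [NormedAddCommGroup W] [NormedSpace ℂ W] (E : V ≃L[ℂ] W) : Tendsto E (𝓝 0) (𝓝 0) := by
  simpa using E.continuous.tendsto 0

/-- A branch is parametrized in every system of coordinates whose `y`-axis it does not contain. -/
theorem IsPlaneBranch.exists_isParametrized {C : Set Plane} (hC : IsPlaneBranch C)
    (E : (ℂ × ℂ) ≃L[ℂ] Plane) (hE : ¬ ∀ᶠ w in 𝓝 (0 : ℂ), E (0, w) ∈ C) :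
    ∃ N y, IsParametrized C E N y := by
  obtain ⟨F, hF, hFC⟩ := hC
  have hcomp : ∀ G : Plane → ℂ, AnalyticAt ℂ G 0 → AnalyticAt ℂ (fun p => G (E p)) 0 := fun G hG =>
    AnalyticAt.fun_comp (g := G) (by simpa using hG) (E.analyticAt 0)
  have hcomp' : ∀ G : ℂ × ℂ → ℂ, AnalyticAt ℂ G 0 → AnalyticAt ℂ (fun p => G (E.symm p)) 0 :=
    fun G hG => AnalyticAt.fun_comp (g := G) (by simpa using hG) (E.symm.analyticAt 0)
  have hFC' := (tendsto_equiv_zero E).eventually hFC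
  obtain ⟨N, y, hN, hy, hy0, h⟩ := exists_parametrization (hcomp F hF.analyticAt)
    (by simpa using hF.apply_zero) (fun G H hG hH hGH => by
      have := hF.unit_or_unit _ _ (hcomp' G hG) (hcomp' H hH) (by
        filter_upwards [(tendsto_equiv_zero E.symm).eventually hGH] with p hp
        simpa using hp)
      simpa using this) (fun hz => hE (by
      have hc : Tendsto (fun w : ℂ => ((0 : ℂ), w)) (𝓝 0) (𝓝 0) := by
        have : ContinuousAt (fun w : ℂ => ((0 : ℂ), w)) 0 := by fun_prop
        exact this
      filter_upwards [hz, hc.eventually hFC'] with w h1 h2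
      exact h2.2 h1))
  refine ⟨N, y, hN, hy, hy0, ?_⟩
  filter_upwards [h, hFC'] with p h1 h2
  rw [h2, h1]

/-- The linear coordinates `(x, y) = (p₀ + μ p₁, p₁)` of a point `p` of the plane. -/
noncomputable def shear (μ : ℂ) : (ℂ × ℂ) ≃L[ℂ] Plane :=
  LinearEquiv.toContinuousLinearEquiv
    { toFun := fun q => !₂[q.1 - μ * q.2, q.2]
      invFun := fun p => (p 0 + μ * p 1, p 1)
      map_add' := fun q r => by
        ext i
        fin_cases i
        · simp; ring
        · simp
      map_smul' := fun c q => by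
        ext i
        fin_cases i
        · simp; ring
        · simp
      left_inv := fun q => by simp
      right_inv := fun p => by
        ext i
        fin_cases i <;> simp }

theorem shear_apply (μ : ℂ) (q : ℂ × ℂ) : shear μ q = !₂[q.1 - μ * q.2, q.2] := rfl

theorem shear_symm_apply (μ : ℂ) (p : Plane) : (shear μ).symm p = (p 0 + μ * p 1, p 1) := rfl

/-- A plane branch does not contain all lines through the origin. -/
theorem IsPlaneBranch.exists_shear {C : Set Plane} (hC : IsPlaneBranch C) :
    ∃ μ, ¬ ∀ᶠ w in 𝓝 (0 : ℂ), shear μ (0, w) ∈ C := by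
  obtain ⟨F, hF, hFC⟩ := hC
  by_contra! hall
  obtain ⟨r, hr, hA⟩ := Metric.eventually_nhds_iff_ball.1 hF.analyticAt.eventually_analyticAt
  have hz : ∀ p ∈ ball (0 : Plane) r, p 1 ≠ 0 → F p = 0 := by
    intro p hp hp1
    have hp0 : p ≠ 0 := fun h => hp1 (by simp [h])
    have hpn : 0 < ‖p‖ := norm_pos_iff.2 hp0
    rw [mem_ball_zero_iff] at hp
    have hline : ∀ s : ℂ, s • p = shear (-(p 0 / p 1)) (0, s * p 1) := by
      intro s
      rw [shear_apply]
      ext i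
      fin_cases i
      · simp; field_simp
      · simp
    have han : AnalyticOnNhd ℂ (fun s : ℂ => F (s • p)) (ball 0 (r / ‖p‖)) := by
      intro s hs
      rw [mem_ball_zero_iff, lt_div_iff₀ hpn, ← norm_smul] at hs
      exact AnalyticAt.fun_comp (g := F) (f := fun s : ℂ => s • p) (hA _ (by simpa using hs))
        (analyticAt_id.smul analyticAt_const)
    have hev : ∀ᶠ s in 𝓝 (0 : ℂ), F (s • p) = 0 := by
      have hc : Tendsto (fun s : ℂ => s * p 1) (𝓝 0) (𝓝 0) := by
        have : ContinuousAt (fun s : ℂ => s * p 1) 0 := by fun_prop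
        simpa [ContinuousAt] using this
      have hc' : Tendsto (fun s : ℂ => s • p) (𝓝 0) (𝓝 0) := by
        have : ContinuousAt (fun s : ℂ => s • p) 0 := by fun_prop
        simpa [ContinuousAt] using this
      filter_upwards [hc.eventually (hall (-(p 0 / p 1))), hc'.eventually hFC] with s h1 h2
      rw [← hline] at h1
      exact h2.1 h1
    have h1 := han.eqOn_zero_of_preconnected_of_eventuallyEq_zero
      (convex_ball _ _).isPreconnected (mem_ball_self (by positivity)) hev
    have h2 := h1 (x := 1) (by simpa [lt_div_iff₀ hpn] using hp)
    simpa using h2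
  have hzero : ∀ᶠ p in 𝓝 (0 : Plane), F p = 0 := by
    filter_upwards [ball_mem_nhds (0 : Plane) hr] with p hp
    have hc : Tendsto (fun s : ℂ => p + s • EuclideanSpace.single (1 : Fin 2) (1 : ℂ)) (𝓝[≠] 0)
        (𝓝 p) := by
      have : ContinuousAt (fun s : ℂ => p + s • EuclideanSpace.single (1 : Fin 2) (1 : ℂ)) 0 := by
        fun_prop
      have h2 : Tendsto _ _ _ := this
      simp only [zero_smul, add_zero] at h2
      exact h2.mono_left nhdsWithin_le_nhds
    have hlim := ((hA p hp).continuousAt.tendsto.comp hc)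
    refine tendsto_nhds_unique hlim (tendsto_const_nhds.congr' ?_)
    filter_upwards [hc.eventually (isOpen_ball.mem_nhds hp),
      eventually_nhdsNE_forall_ne (d := 1) (fun _ => -p 1) 0] with s h1 h2
    refine (hz _ h1 ?_).symm
    have h3 := h2 0 (by simp)
    intro h4
    refine h3 (eq_neg_of_add_eq_zero_right ?_)
    simpa using h4
  have := hF.unit_or_unit (fun _ => 0) (fun _ => 0) analyticAt_const analyticAt_const (by
    simpa using hzero)
  simp at this

namespace IsParametrized

variable {C : Set Plane} {E : (ℂ × ℂ) ≃L[ℂ] Plane} {N : ℕ} {y : ℂ → ℂ}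

theorem tendsto_curve (h : IsParametrized C E N y) :
    Tendsto (fun t : ℂ => (t ^ N, y t)) (𝓝 0) (𝓝 0) := by
  have : ContinuousAt (fun t : ℂ => (t ^ N, y t)) 0 :=
    (continuousAt_id.pow N).prodMk h.analyticAt.continuousAt
  simpa [ContinuousAt, h.ne_zero, h.apply_zero, ← Prod.mk_zero_zero] using this

theorem tendsto_param (h : IsParametrized C E N y) :
    Tendsto (fun t : ℂ => E (t ^ N, y t)) (𝓝 0) (𝓝 0) :=
  (tendsto_equiv_zero E).comp h.tendsto_curve

theorem eventually_mem (h : IsParametrized C E N y) : ∀ᶠ t in 𝓝 (0 : ℂ), E (t ^ N, y t) ∈ C := by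
  filter_upwards [h.tendsto_curve.eventually h.mem_iff] with t ht
  exact ht.2 ⟨t, rfl, rfl⟩

theorem zero_mem (h : IsParametrized C E N y) : (0 : Plane) ∈ C := by
  have := h.eventually_mem.self_of_nhds
  simpa [h.ne_zero, h.apply_zero, Prod.mk_zero_zero] using this

theorem _root_.HolderCurves.param_ne_zero (E : (ℂ × ℂ) ≃L[ℂ] Plane) (N : ℕ) (y : ℂ → ℂ) {t : ℂ}
    (ht : t ≠ 0) : E (t ^ N, y t) ≠ 0 := by
  intro h0
  rw [ContinuousLinearEquiv.map_eq_zero_iff, Prod.ext_iff] at h0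
  exact pow_ne_zero N ht h0.1

/-- Points of the curve near the origin have small parameters. -/
theorem eventually_exists_param (h : IsParametrized C E N y) {P : ℂ → Prop}
    (hP : ∀ᶠ t in 𝓝 (0 : ℂ), P t) :
    ∀ᶠ p in 𝓝 (0 : Plane), p ∈ C → ∃ t, P t ∧ p = E (t ^ N, y t) := by
  have h1 := eventually_forall_pow_eq N
    ((continuousAt_fst (p := (0 : ℂ × ℂ))).eventually (p := P) hP)
  filter_upwards [(tendsto_equiv_zero E.symm).eventually (h.mem_iff.and h1)] with p hp hpC
  obtain ⟨t, ht, hyt⟩ := hp.1.1 (by simpa using hpC)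
  exact ⟨t, hp.2 t ht, by rw [ht, hyt]; simp⟩

/-- A branch has a tangent line: only one shear direction can be tangent to it. -/
theorem exists_transversal (h : IsParametrized C E N y) :
    ∃ b : ℂ, ∀ μ ≠ b, ∃ K : ℝ, ∀ᶠ p in 𝓝 (0 : Plane), p ∈ C → ‖p‖ ≤ K * ‖p 0 + μ * p 1‖ := by
  let φ : ℂ → Plane := fun t => E (t ^ N, y t)
  have hφ : AnalyticAt ℂ φ 0 := AnalyticAt.fun_comp (g := E) (E.analyticAt _)
    ((analyticAt_id.pow N).prod h.analyticAt)
  obtain ⟨m, g, hg, hg0, hgφ⟩ := hφ.exists_eventuallyEq_pow_smul_nonzero_iff.2 (fun h0 => by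
    have h0' : ∀ᶠ t in 𝓝[≠] (0 : ℂ), φ t = 0 := nhdsWithin_le_nhds h0
    obtain ⟨t, ht, ht0⟩ := (h0'.and self_mem_nhdsWithin).exists
    exact param_ne_zero E N y ht0 ht)
  obtain ⟨b, hb⟩ : ∃ b : ℂ, ∀ μ ≠ b, g 0 0 + μ * g 0 1 ≠ 0 := by
    by_cases h1 : g 0 1 = 0
    · refine ⟨0, fun μ _ h2 => hg0 ?_⟩
      rw [h1, mul_zero, add_zero] at h2
      ext i
      fin_cases i
      · exact h2
      · exact h1
    · refine ⟨-(g 0 0 / g 0 1), fun μ hμ h2 => hμ ?_⟩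
      field_simp
      linear_combination h2
  refine ⟨b, fun μ hμ => ?_⟩
  have hℓ : ContinuousAt (fun t => ‖g t 0 + μ * g t 1‖) 0 := by
    have := hg.continuousAt
    fun_prop
  have hpos : 0 < ‖g 0 0 + μ * g 0 1‖ := norm_pos_iff.2 (hb μ hμ)
  set e := ‖g 0 0 + μ * g 0 1‖ with he
  refine ⟨(‖g 0‖ + 1) / (e / 2), ?_⟩
  have h1 : ∀ᶠ t in 𝓝 (0 : ℂ), e / 2 < ‖g t 0 + μ * g t 1‖ :=
    hℓ.eventually (eventually_gt_nhds (half_lt_self hpos))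
  have h2 : ∀ᶠ t in 𝓝 (0 : ℂ), ‖g t‖ < ‖g 0‖ + 1 :=
    hg.continuousAt.norm.eventually (eventually_lt_nhds (by linarith))
  filter_upwards [h.eventually_exists_param (h1.and (h2.and hgφ))] with p hp hpC
  obtain ⟨t, ⟨h1, h2, h3⟩, rfl⟩ := hp hpC
  change ‖φ t‖ ≤ _ * ‖φ t 0 + μ * φ t 1‖
  rw [sub_zero] at h3
  rw [h3]
  have h4 : (t ^ m • g t) 0 + μ * (t ^ m • g t) 1 = t ^ m * (g t 0 + μ * g t 1) := by
    simp
    ring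
  rw [h4, norm_smul, norm_mul, mul_left_comm]
  refine mul_le_mul_of_nonneg_left ?_ (norm_nonneg _)
  rw [div_mul_eq_mul_div, le_div_iff₀ (by positivity)]
  exact mul_le_mul h2.le h1.le (by positivity) (by positivity)

/-- Passing to a multiple of the denominator `N`. -/
theorem comp_pow (h : IsParametrized C E N y) {M : ℕ} (hM : M ≠ 0) :
    IsParametrized C E (M * N) fun t => y (t ^ M) where
  ne_zero := mul_ne_zero hM h.ne_zero
  analyticAt := AnalyticAt.comp_of_eq_apply h.analyticAt (analyticAt_id.pow M) (by simp [hM])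
  apply_zero := by simp [hM, h.apply_zero]
  mem_iff := by
    filter_upwards [h.mem_iff] with p hp
    rw [hp]
    constructor
    · rintro ⟨t, ht, hyt⟩
      refine ⟨t ^ ((M : ℂ)⁻¹), ?_, ?_⟩
      · rw [pow_mul, cpow_nat_inv_pow t hM, ht]
      · rw [cpow_nat_inv_pow t hM, hyt]
    · rintro ⟨t, ht, hyt⟩
      exact ⟨t ^ M, by rw [← pow_mul, ht], hyt⟩

end IsParametrized

/-- For all but one shear direction, the parametrization of a branch satisfies `y(t) = O(tᴺ)`. -/
theorem IsPlaneBranch.exists_transversal {C : Set Plane} (hC : IsPlaneBranch C) :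
    ∃ b : ℂ, ∀ μ ≠ b, ∃ (N : ℕ) (y : ℂ → ℂ) (K : ℝ), IsParametrized C (shear μ) N y ∧
      ∀ᶠ t in 𝓝 (0 : ℂ), ‖y t‖ ≤ K * ‖t‖ ^ N := by
  obtain ⟨μ₀, hμ₀⟩ := hC.exists_shear
  obtain ⟨N₀, y₀, h₀⟩ := hC.exists_isParametrized _ hμ₀
  obtain ⟨b, hb⟩ := h₀.exists_transversal
  refine ⟨b, fun μ hμ => ?_⟩
  obtain ⟨K, hK⟩ := hb μ hμ
  have hbound : ∀ᶠ q in 𝓝 (0 : ℂ × ℂ), shear μ q ∈ C → ‖q.2‖ ≤ K * ‖q.1‖ := by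
    filter_upwards [(tendsto_equiv_zero (shear μ)).eventually hK] with q hq hqC
    have h1 := hq hqC
    have h2 : (shear μ q 0 + μ * shear μ q 1, shear μ q 1) = q := by
      rw [← shear_symm_apply, ContinuousLinearEquiv.symm_apply_apply]
    have h3 := congrArg Prod.fst h2
    have h4 := congrArg Prod.snd h2
    simp only at h3 h4
    rw [h3] at h1
    rw [← h4]
    refine (PiLp.norm_apply_le (shear μ q) 1).trans ?_
    simpa [h4] using h1
  obtain ⟨N, y, h⟩ := hC.exists_isParametrized (shear μ) (fun hall => by
    have hc : Tendsto (fun w : ℂ => ((0 : ℂ), w)) (𝓝[≠] 0) (𝓝 0) := by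
      have : ContinuousAt (fun w : ℂ => ((0 : ℂ), w)) 0 := by fun_prop
      exact this.tendsto.mono_left nhdsWithin_le_nhds
    obtain ⟨w, ⟨h1, h2⟩, h3⟩ := ((hc.eventually hbound).and
      (nhdsWithin_le_nhds hall)).and self_mem_nhdsWithin |>.exists
    have := h1 h2
    simp at this
    exact h3 this)
  refine ⟨N, y, K, h, ?_⟩
  filter_upwards [h.tendsto_curve.eventually hbound, h.eventually_mem] with t h1 h2
  simpa using h1 h2

/-- Two plane branches are parametrized in common linear coordinates, with a common denominator,
transversally to the direction of projection. -/
theorem exists_common_parametrization {C₁ C₂ : Set Plane} (h₁ : IsPlaneBranch C₁)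
    (h₂ : IsPlaneBranch C₂) : ∃ (E : (ℂ × ℂ) ≃L[ℂ] Plane) (N : ℕ) (y₁ y₂ : ℂ → ℂ) (K : ℝ),
      IsParametrized C₁ E N y₁ ∧ IsParametrized C₂ E N y₂ ∧
      (∀ᶠ t in 𝓝 (0 : ℂ), ‖y₁ t‖ ≤ K * ‖t‖ ^ N) ∧ ∀ᶠ t in 𝓝 (0 : ℂ), ‖y₂ t‖ ≤ K * ‖t‖ ^ N := by
  obtain ⟨b₁, hb₁⟩ := h₁.exists_transversal
  obtain ⟨b₂, hb₂⟩ := h₂.exists_transversal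
  obtain ⟨μ, hμ⟩ := Set.Infinite.exists_notMem_finset (Set.infinite_univ (α := ℂ)) {b₁, b₂}
  simp only [Finset.mem_insert, Finset.mem_singleton, not_or] at hμ
  obtain ⟨N₁, y₁, K₁, hp₁, hK₁⟩ := hb₁ μ hμ.2.1
  obtain ⟨N₂, y₂, K₂, hp₂, hK₂⟩ := hb₂ μ hμ.2.2
  have hpow : ∀ {M : ℕ}, M ≠ 0 → Tendsto (fun t : ℂ => t ^ M) (𝓝 0) (𝓝 0) := fun {M} hM => by
    have : ContinuousAt (fun t : ℂ => t ^ M) 0 := by fun_prop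
    simpa [ContinuousAt, hM] using this
  refine ⟨shear μ, N₂ * N₁, _, _, max K₁ K₂, hp₁.comp_pow hp₂.ne_zero,
    mul_comm N₁ N₂ ▸ hp₂.comp_pow hp₁.ne_zero, ?_, ?_⟩
  · filter_upwards [(hpow hp₂.ne_zero).eventually hK₁] with t ht
    rw [norm_pow, ← pow_mul] at ht
    exact ht.trans (mul_le_mul_of_nonneg_right (le_max_left _ _) (by positivity))
  · filter_upwards [(hpow hp₁.ne_zero).eventually hK₂] with t ht
    rw [norm_pow, ← pow_mul, mul_comm N₁ N₂] at ht
    exact ht.trans (mul_le_mul_of_nonneg_right (le_max_right _ _) (by positivity))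

/-! ### Logarithmic order -/

theorem coe_eq_log_div_log {r : ℝ} (hr : 0 < r) (hr1 : r < 1) (b : ℝ) :
    (b : EReal) = ENNReal.log (ENNReal.ofReal (r ^ b)) / ((Real.log r : ℝ) : EReal) := by
  rw [ENNReal.log_ofReal_of_pos (Real.rpow_pos_of_pos hr b), Real.log_rpow hr, ← EReal.coe_div,
    mul_div_cancel_right₀ _ (Real.log_neg hr hr1).ne]

theorem log_div_log_lt_log_div_log_iff {g h : ℝ≥0∞} {r : ℝ} (hr : 0 < r) (hr1 : r < 1) :
    ENNReal.log g / ((Real.log r : ℝ) : EReal) < ENNReal.log h / ((Real.log r : ℝ) : EReal) ↔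
      h < g := by
  have hc : ((Real.log r : ℝ) : EReal) < 0 := by exact_mod_cast Real.log_neg hr hr1
  rw [← ENNReal.log_lt_log_iff]
  refine ⟨fun hlt => ?_, fun hlt => EReal.div_lt_div_right_of_neg hc (EReal.coe_ne_bot _) hlt⟩
  by_contra hn
  exact absurd hlt (not_lt.2 (EReal.div_le_div_right_of_nonpos hc.le (not_lt.1 hn)))

theorem log_div_log_lt_iff {g : ℝ≥0∞} {r b : ℝ} (hr : 0 < r) (hr1 : r < 1) :
    ENNReal.log g / ((Real.log r : ℝ) : EReal) < b ↔ ENNReal.ofReal (r ^ b) < g := by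
  rw [coe_eq_log_div_log hr hr1 b, log_div_log_lt_log_div_log_iff hr hr1]

theorem lt_log_div_log_iff {g : ℝ≥0∞} {r b : ℝ} (hr : 0 < r) (hr1 : r < 1) :
    (b : EReal) < ENNReal.log g / ((Real.log r : ℝ) : EReal) ↔ g < ENNReal.ofReal (r ^ b) := by
  rw [coe_eq_log_div_log hr hr1 b, log_div_log_lt_log_div_log_iff hr hr1]

theorem eventually_mul_rpow_lt {a b : ℝ} (hab : b < a) (C : ℝ) :
    ∀ᶠ r in 𝓝[>] (0 : ℝ), C * r ^ a < r ^ b := by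
  have h1 : Tendsto (fun r : ℝ => C * r ^ (a - b)) (𝓝[>] 0) (𝓝 0) := by
    have h2 : ContinuousAt (fun r : ℝ => C * r ^ (a - b)) 0 :=
      continuousAt_const.mul (Real.continuousAt_rpow_const 0 (a - b) (Or.inr (by linarith)))
    have h3 := h2.tendsto.mono_left (nhdsWithin_le_nhds (s := Set.Ioi 0))
    rwa [Real.zero_rpow (by linarith : a - b ≠ 0), mul_zero] at h3
  filter_upwards [h1.eventually (eventually_lt_nhds one_pos), self_mem_nhdsWithin] with r hr hr0
  have hr0 : 0 < r := hr0
  have h4 := mul_lt_mul_of_pos_right hr (Real.rpow_pos_of_pos hr0 b)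
  rwa [one_mul, mul_assoc, ← Real.rpow_add hr0, sub_add_cancel] at h4

theorem eventually_pos_and_lt {δ : ℝ} (hδ : 0 < δ) : ∀ᶠ r in 𝓝[>] (0 : ℝ), 0 < r ∧ r < δ :=
  Ioo_mem_nhdsGT hδ

theorem tendsto_log_div_log {g : ℝ → ℝ≥0∞} {κ c C : ℝ} (hc : 0 < c)
    (hlow : ∀ᶠ r in 𝓝[>] (0 : ℝ), ENNReal.ofReal (c * r ^ κ) ≤ g r)
    (hup : ∀ᶠ r in 𝓝[>] (0 : ℝ), g r ≤ ENNReal.ofReal (C * r ^ κ)) :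
    Tendsto (fun r => ENNReal.log (g r) / ((Real.log r : ℝ) : EReal)) (𝓝[>] 0)
      (𝓝 (κ : EReal)) := by
  refine tendsto_order.2 ⟨fun a ha => ?_, fun a ha => ?_⟩
  · obtain ⟨b, hab, hb⟩ := EReal.lt_iff_exists_real_btwn.1 ha
    filter_upwards [hup, eventually_mul_rpow_lt (EReal.coe_lt_coe_iff.1 hb) C,
      eventually_pos_and_lt one_pos] with r h1 h2 h3
    refine hab.trans ((lt_log_div_log_iff h3.1 h3.2).2 (h1.trans_lt ?_))
    exact (ENNReal.ofReal_lt_ofReal_iff (Real.rpow_pos_of_pos h3.1 b)).2 h2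
  · obtain ⟨b, hb, hba⟩ := EReal.lt_iff_exists_real_btwn.1 ha
    filter_upwards [hlow, eventually_mul_rpow_lt (EReal.coe_lt_coe_iff.1 hb) c⁻¹,
      eventually_pos_and_lt one_pos] with r h1 h2 h3
    refine ((log_div_log_lt_iff h3.1 h3.2).2 (lt_of_lt_of_le ?_ h1)).trans hba
    refine (ENNReal.ofReal_lt_ofReal_iff (mul_pos hc (Real.rpow_pos_of_pos h3.1 κ))).2 ?_
    rwa [inv_mul_lt_iff₀ hc] at h2

/-! ### Existence of the contact -/

/-- The inequality `|t - ζs| max(|t|, |s|)^(N-1) ≤ C |tᴺ - sᴺ|`, where `ζs` is the rotation of `s`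
closest to `t`: the other factors `t - ζ's` of `tᴺ - sᴺ` are comparable to `max(|t|, |s|)`. -/
theorem exists_root_of_unity_norm_sub_mul_le {N : ℕ} (hN : N ≠ 0) :
    ∃ C : ℝ, 0 < C ∧ ∀ t s : ℂ, ∃ ζ : ℂ, ζ ^ N = 1 ∧
      ‖t - ζ * s‖ * max ‖t‖ ‖s‖ ^ (N - 1) ≤ C * ‖t ^ N - s ^ N‖ := by
  classical
  obtain ⟨ω, hω⟩ : ∃ ω : ℂ, IsPrimitiveRoot ω N := ⟨_, isPrimitiveRoot_exp N hN⟩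
  let R := Polynomial.nthRootsFinset N (1 : ℂ)
  have hR : ∀ ζ, ζ ∈ R ↔ ζ ^ N = 1 := fun ζ =>
    Polynomial.mem_nthRootsFinset (Nat.pos_of_ne_zero hN) 1
  have hRne : R.Nonempty := ⟨1, (hR 1).2 (one_pow N)⟩
  obtain ⟨δ, hδ, hsep⟩ : ∃ δ : ℝ, 0 < δ ∧ ∀ ζ ∈ R, ∀ ξ ∈ R, ζ ≠ ξ → δ ≤ ‖ζ - ξ‖ := by
    by_cases hoff : R.offDiag.Nonempty
    · obtain ⟨q, hq, hmin⟩ := R.offDiag.exists_min_image (fun q => ‖q.1 - q.2‖) hoff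
      refine ⟨‖q.1 - q.2‖, norm_pos_iff.2 (sub_ne_zero.2 (Finset.mem_offDiag.1 hq).2.2), ?_⟩
      exact fun ζ hζ ξ hξ hne => hmin (ζ, ξ) (Finset.mem_offDiag.2 ⟨hζ, hξ, hne⟩)
    · refine ⟨1, one_pos, fun ζ hζ ξ hξ hne => absurd ⟨(ζ, ξ), ?_⟩ hoff⟩
      exact Finset.mem_offDiag.2 ⟨hζ, hξ, hne⟩
  set A := 1 + 2 / δ with hA
  have hA0 : 0 < A := by positivity
  refine ⟨A ^ (N - 1), pow_pos hA0 _, fun t s => ?_⟩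
  obtain ⟨ζ₀, hζ₀, hmin⟩ := R.exists_min_image (fun ζ => ‖t - ζ * s‖) hRne
  refine ⟨ζ₀, (hR ζ₀).1 hζ₀, ?_⟩
  have hother : ∀ ζ ∈ R.erase ζ₀, max ‖t‖ ‖s‖ ≤ A * ‖t - ζ * s‖ := by
    intro ζ hζ
    obtain ⟨hne, hζR⟩ := Finset.mem_erase.1 hζ
    have h1 : δ * ‖s‖ ≤ 2 * ‖t - ζ * s‖ := by
      calc δ * ‖s‖ ≤ ‖ζ - ζ₀‖ * ‖s‖ :=
            mul_le_mul_of_nonneg_right (hsep ζ hζR ζ₀ hζ₀ hne) (norm_nonneg _)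
        _ = ‖(t - ζ₀ * s) - (t - ζ * s)‖ := by rw [← norm_mul]; congr 1; ring
        _ ≤ ‖t - ζ₀ * s‖ + ‖t - ζ * s‖ := norm_sub_le _ _
        _ ≤ 2 * ‖t - ζ * s‖ := by linarith [hmin ζ hζR]
    have h2 : ‖s‖ ≤ 2 / δ * ‖t - ζ * s‖ := by
      rw [div_mul_eq_mul_div, le_div_iff₀ hδ]
      linarith
    have h3 : ‖t‖ ≤ ‖t - ζ * s‖ + ‖s‖ := by
      have h4 : ‖ζ * s‖ = ‖s‖ := by
        rw [norm_mul, norm_eq_one_of_pow_eq_one ((hR ζ).1 hζR) hN, one_mul]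
      calc ‖t‖ = ‖(t - ζ * s) + ζ * s‖ := by rw [sub_add_cancel]
        _ ≤ _ := by rw [← h4]; exact norm_add_le _ _
    rw [hA, add_mul, one_mul]
    exact max_le (by linarith) (by linarith [norm_nonneg (t - ζ * s)])
  have hprod : ‖t ^ N - s ^ N‖ = ‖t - ζ₀ * s‖ * ∏ ζ ∈ R.erase ζ₀, ‖t - ζ * s‖ := by
    rw [hω.pow_sub_pow_eq_prod_sub_mul t s (Nat.pos_of_ne_zero hN), norm_prod,
      ← Finset.mul_prod_erase _ _ hζ₀]
  have hcard : (R.erase ζ₀).card = N - 1 := by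
    rw [Finset.card_erase_of_mem hζ₀, hω.card_nthRootsFinset]
  have hle : max ‖t‖ ‖s‖ ^ (N - 1) ≤ A ^ (N - 1) * ∏ ζ ∈ R.erase ζ₀, ‖t - ζ * s‖ := by
    rw [← hcard, ← Finset.prod_const, ← Finset.prod_const, ← Finset.prod_mul_distrib]
    exact Finset.prod_le_prod (fun _ _ => le_max_of_le_left (norm_nonneg _)) hother
  rw [hprod, mul_left_comm]
  exact mul_le_mul_of_nonneg_left hle (norm_nonneg _)

/-- Cauchy's estimate bounds the derivative of a function that is `O(tᴺ)`. -/
theorem exists_norm_sub_le_of_norm_le_pow {y : ℂ → ℂ} (hy : AnalyticAt ℂ y 0) {N : ℕ} (hN : N ≠ 0)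
    {K : ℝ} (hK : ∀ᶠ t in 𝓝 (0 : ℂ), ‖y t‖ ≤ K * ‖t‖ ^ N) :
    ∃ r > 0, ∃ L : ℝ, 0 < L ∧ ∀ s t : ℂ, ‖s‖ < r → ‖t‖ < r →
      ‖y s - y t‖ ≤ L * max ‖s‖ ‖t‖ ^ (N - 1) * ‖s - t‖ := by
  obtain ⟨R, hR, h⟩ := Metric.eventually_nhds_iff_ball.1 (hK.and hy.eventually_analyticAt)
  simp only [mem_ball_zero_iff] at h
  refine ⟨R / 2, by positivity, |K| * 2 ^ N + 1, by positivity, fun s t hs ht => ?_⟩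
  set M := max ‖s‖ ‖t‖ with hM
  have hMR : M < R / 2 := max_lt hs ht
  rcases (le_max_of_le_left (norm_nonneg s) : 0 ≤ M).eq_or_lt with hM0 | hM0
  · have h1 : ‖s‖ ≤ 0 := (le_max_left _ _).trans hM0.ge
    have h2 : ‖t‖ ≤ 0 := (le_max_right _ _).trans hM0.ge
    rw [norm_le_zero_iff] at h1 h2
    simp [h1, h2]
  have hderiv : ∀ z ∈ closedBall (0 : ℂ) M, ‖deriv y z‖ ≤ (|K| * 2 ^ N + 1) * M ^ (N - 1) := by
    intro z hz
    rw [mem_closedBall_zero_iff] at hz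
    have hin : ∀ w ∈ closedBall z M, ‖w‖ ≤ 2 * M := by
      intro w hw
      rw [mem_closedBall, dist_eq_norm] at hw
      calc ‖w‖ = ‖(w - z) + z‖ := by rw [sub_add_cancel]
        _ ≤ _ := (norm_add_le _ _).trans (by linarith)
    have h1 : ‖deriv y z‖ ≤ |K| * (2 * M) ^ N / M := by
      refine norm_deriv_le_of_forall_mem_sphere_norm_le hM0 ?_ ?_
      · refine DifferentiableOn.diffContOnCl fun w hw => ?_
        rw [closure_ball _ hM0.ne'] at hw
        exact (h w (by linarith [hin w hw])).2.differentiableAt.differentiableWithinAt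
      · intro w hw
        have h2 := hin w (sphere_subset_closedBall hw)
        refine (h w (by linarith)).1.trans ?_
        exact mul_le_mul (le_abs_self K) (pow_le_pow_left₀ (norm_nonneg _) h2 N) (by positivity)
          (abs_nonneg _)
    refine h1.trans ?_
    rw [div_le_iff₀ hM0, mul_pow, mul_assoc _ (M ^ (N - 1)), pow_sub_one_mul hN, ← mul_assoc]
    exact mul_le_mul_of_nonneg_right (by linarith) (by positivity)
  have := (convex_closedBall (0 : ℂ) M).norm_image_sub_le_of_norm_deriv_le (𝕜 := ℂ) (f := y)
    (fun z hz => (h z (by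
      rw [mem_closedBall_zero_iff] at hz
      linarith)).2.differentiableAt) hderiv
    (x := t) (y := s) (by simp [hM]) (by simp [hM])
  exact this

theorem exists_norm_equiv_pow {f : ℂ → ℂ} (hf : AnalyticAt ℂ f 0)
    (hne : ¬ ∀ᶠ t in 𝓝 (0 : ℂ), f t = 0) :
    ∃ (o : ℕ) (c C : ℝ), 0 < c ∧ 0 < C ∧
      ∀ᶠ t in 𝓝 (0 : ℂ), c * ‖t‖ ^ o ≤ ‖f t‖ ∧ ‖f t‖ ≤ C * ‖t‖ ^ o := by
  obtain ⟨o, g, hg, hg0, h⟩ := hf.exists_eventuallyEq_pow_smul_nonzero_iff.2 hne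
  have hpos : 0 < ‖g 0‖ := norm_pos_iff.2 hg0
  refine ⟨o, ‖g 0‖ / 2, 2 * ‖g 0‖, by positivity, by positivity, ?_⟩
  filter_upwards [h, hg.continuousAt.norm.eventually (eventually_gt_nhds (half_lt_self hpos)),
    hg.continuousAt.norm.eventually (eventually_lt_nhds (by linarith : ‖g 0‖ < 2 * ‖g 0‖))]
    with t h1 h2 h3
  rw [h1, sub_zero, norm_smul, norm_pow, mul_comm (‖t‖ ^ o)]
  exact ⟨mul_le_mul_of_nonneg_right h2.le (by positivity),
    mul_le_mul_of_nonneg_right h3.le (by positivity)⟩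

/-- The distance from a point of parameter `t` of one curve to the other curve is comparable to a
power of `|t|`, unless the curves coincide. The exponent is the largest order of vanishing of the
differences `y₁(t) - y₂(ζt)`, for `ζᴺ = 1`. -/
theorem exists_separation {y₁ y₂ : ℂ → ℂ} (h₁ : AnalyticAt ℂ y₁ 0) (h₂ : AnalyticAt ℂ y₂ 0)
    {N : ℕ} (hN : N ≠ 0) {K : ℝ} (hK : ∀ᶠ t in 𝓝 (0 : ℂ), ‖y₂ t‖ ≤ K * ‖t‖ ^ N)
    (hne : ∀ ζ : ℂ, ζ ^ N = 1 → ¬ ∀ᶠ t in 𝓝 (0 : ℂ), y₁ t = y₂ (ζ * t)) :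
    ∃ (κ : ℕ) (c C r : ℝ), 0 < c ∧ 0 < r ∧
      (∀ t s : ℂ, ‖t‖ < r → ‖s‖ < r → c * ‖t‖ ^ κ ≤ ‖(t ^ N, y₁ t) - (s ^ N, y₂ s)‖) ∧
      ∀ t : ℂ, ‖t‖ < r → ∃ s : ℂ, ‖s‖ = ‖t‖ ∧ ‖(t ^ N, y₁ t) - (s ^ N, y₂ s)‖ ≤ C * ‖t‖ ^ κ := by
  classical
  let R := Polynomial.nthRootsFinset N (1 : ℂ)
  have hR : ∀ ζ, ζ ∈ R ↔ ζ ^ N = 1 := fun ζ =>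
    Polynomial.mem_nthRootsFinset (Nat.pos_of_ne_zero hN) 1
  have hRne : R.Nonempty := ⟨1, (hR 1).2 (one_pow N)⟩
  have hex : ∀ ζ : ℂ, ∃ (o : ℕ) (c C : ℝ), 0 < c ∧ 0 < C ∧ (ζ ∈ R → ∀ᶠ t in 𝓝 (0 : ℂ),
      c * ‖t‖ ^ o ≤ ‖y₁ t - y₂ (ζ * t)‖ ∧ ‖y₁ t - y₂ (ζ * t)‖ ≤ C * ‖t‖ ^ o) := by
    intro ζ
    by_cases hζ : ζ ∈ R
    · have ha : AnalyticAt ℂ (fun t => y₁ t - y₂ (ζ * t)) 0 :=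
        h₁.sub (AnalyticAt.comp_of_eq_apply h₂ (analyticAt_const.mul analyticAt_id) (by simp))
      obtain ⟨o, c, C, hc, hC, h⟩ := exists_norm_equiv_pow ha (by
        simpa [sub_eq_zero] using hne ζ ((hR ζ).1 hζ))
      exact ⟨o, c, C, hc, hC, fun _ => h⟩
    · exact ⟨0, 1, 1, one_pos, one_pos, fun h => absurd h hζ⟩
  choose o c C hc hC hbd using hex
  obtain ⟨ζ₀, hζ₀, hmax⟩ := R.exists_max_image o hRne
  obtain ⟨ζ₁, hζ₁, hcmin⟩ := R.exists_min_image c hRne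
  obtain ⟨C₁, hC₁, hroot⟩ := exists_root_of_unity_norm_sub_mul_le hN
  obtain ⟨r₁, hr₁, L, hL, hlip⟩ := exists_norm_sub_le_of_norm_le_pow h₂ hN hK
  obtain ⟨r₂, hr₂, hall⟩ := Metric.eventually_nhds_iff_ball.1
    ((Filter.eventually_all_finset R).2 hbd)
  simp only [mem_ball_zero_iff] at hall
  refine ⟨o ζ₀, c ζ₁ / (1 + L * C₁), C ζ₀, min 1 (min r₁ r₂), ?_, by positivity, ?_, ?_⟩
  · have := hc ζ₁
    positivity
  · intro t s ht hs
    simp only [lt_min_iff] at ht hs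
    obtain ⟨ζ, hζ, h⟩ := hroot s t
    set D := ‖(t ^ N, y₁ t) - (s ^ N, y₂ s)‖ with hD
    have hD1 : ‖t ^ N - s ^ N‖ ≤ D := norm_fst_le ((t ^ N, y₁ t) - (s ^ N, y₂ s))
    have hD2 : ‖y₁ t - y₂ s‖ ≤ D := norm_snd_le ((t ^ N, y₁ t) - (s ^ N, y₂ s))
    have hζt : ‖ζ * t‖ = ‖t‖ := by rw [norm_mul, norm_eq_one_of_pow_eq_one hζ hN, one_mul]
    have h3 : ‖y₂ s - y₂ (ζ * t)‖ ≤ L * C₁ * D := by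
      refine (hlip s (ζ * t) hs.2.1 (by rw [hζt]; exact ht.2.1)).trans ?_
      rw [hζt, mul_assoc, mul_assoc]
      refine mul_le_mul_of_nonneg_left ?_ hL.le
      rw [mul_comm]
      refine h.trans (mul_le_mul_of_nonneg_left ?_ hC₁.le)
      rwa [norm_sub_rev]
    have h4 : ‖y₁ t - y₂ (ζ * t)‖ ≤ (1 + L * C₁) * D := by
      calc ‖y₁ t - y₂ (ζ * t)‖ = ‖(y₁ t - y₂ s) + (y₂ s - y₂ (ζ * t))‖ := by
            rw [sub_add_sub_cancel]
        _ ≤ ‖y₁ t - y₂ s‖ + ‖y₂ s - y₂ (ζ * t)‖ := norm_add_le _ _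
        _ ≤ (1 + L * C₁) * D := by linarith
    have hζR := (hR ζ).2 hζ
    have h5 := (hall t ht.2.2 ζ hζR).1
    have h6 : c ζ₁ * ‖t‖ ^ o ζ₀ ≤ c ζ * ‖t‖ ^ o ζ :=
      mul_le_mul (hcmin ζ hζR) (pow_le_pow_of_le_one (norm_nonneg _) ht.1.le (hmax ζ hζR))
        (by positivity) (hc ζ).le
    rw [div_mul_eq_mul_div, div_le_iff₀ (by positivity)]
    linarith [mul_comm D (1 + L * C₁)]
  · intro t ht
    simp only [lt_min_iff] at ht
    have hζ := (hR ζ₀).1 hζ₀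
    refine ⟨ζ₀ * t, by rw [norm_mul, norm_eq_one_of_pow_eq_one hζ hN, one_mul], ?_⟩
    rw [mul_pow, hζ, one_mul, Prod.mk_sub_mk, sub_self, Prod.norm_mk, norm_zero,
      max_eq_right (norm_nonneg _)]
    exact (hall t ht.2.2 ζ₀ hζ₀).2

theorem le_gap {Γ₁ Γ₂ : Set Plane} {r : ℝ} {b : ℝ≥0∞}
    (h : ∀ p ∈ Γ₁, ∀ q ∈ Γ₂, r ≤ ‖p‖ → r ≤ ‖q‖ → b ≤ edist p q) : b ≤ gap Γ₁ Γ₂ r :=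
  le_iInf₂ fun p hp => le_iInf₂ fun q hq => le_iInf₂ fun h1 h2 => h p hp q hq h1 h2

theorem gap_le {Γ₁ Γ₂ : Set Plane} {r : ℝ} {p q : Plane} (hp : p ∈ Γ₁) (hq : q ∈ Γ₂)
    (hpr : r ≤ ‖p‖) (hqr : r ≤ ‖q‖) : gap Γ₁ Γ₂ r ≤ edist p q :=
  iInf₂_le_of_le p hp (iInf₂_le_of_le q hq (iInf₂_le_of_le hpr hqr le_rfl))

theorem gap_comm (Γ₁ Γ₂ : Set Plane) (r : ℝ) : gap Γ₁ Γ₂ r = gap Γ₂ Γ₁ r :=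
  le_antisymm (le_gap fun p hp q hq h1 h2 => edist_comm p q ▸ gap_le hq hp h2 h1)
    (le_gap fun p hp q hq h1 h2 => edist_comm p q ▸ gap_le hq hp h2 h1)

theorem HasContact.symm {Γ₁ Γ₂ : Set Plane} {c : EReal} (h : HasContact Γ₁ Γ₂ c) :
    HasContact Γ₂ Γ₁ c := by
  simpa only [HasContact, gap_comm] using h

/-- If the two sets meet away from the origin, then the gap vanishes for small `r` and `ln 0 = -∞`
makes the quotient `+∞`. -/
theorem tendsto_top_of_mem_inter {Γ₁ Γ₂ : Set Plane} {p : Plane} (h₁ : p ∈ Γ₁) (h₂ : p ∈ Γ₂)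
    (hp : p ≠ 0) : Tendsto (fun r : ℝ => ENNReal.log (gap Γ₁ Γ₂ r) / ((Real.log r : ℝ) : EReal))
      (𝓝[>] 0) (𝓝 ⊤) := by
  refine tendsto_const_nhds.congr' ?_
  filter_upwards [eventually_pos_and_lt (norm_pos_iff.2 hp), eventually_pos_and_lt one_pos]
    with r h3 h4
  have h5 : gap Γ₁ Γ₂ r = 0 := by
    have := gap_le h₁ h₂ h3.2.le h3.2.le
    rwa [edist_self, nonpos_iff_eq_zero] at this
  have h6 : ((Real.log r : ℝ) : EReal) < 0 := by exact_mod_cast Real.log_neg h4.1 h4.2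
  rw [h5, ENNReal.log_zero, EReal.bot_div_of_neg_ne_bot h6 (EReal.coe_ne_bot _)]

/-- If `y₁(t) = y₂(ζt)` with `ζᴺ = 1`, then the two curves coincide and their contact is `+∞`. -/
theorem hasContact_top_of_rotation {C₁ C₂ : Set Plane} {E : (ℂ × ℂ) ≃L[ℂ] Plane} {N : ℕ}
    {y₁ y₂ : ℂ → ℂ} (h₁ : IsParametrized C₁ E N y₁) (h₂ : IsParametrized C₂ E N y₂) {ζ : ℂ}
    (hζ : ζ ^ N = 1) (heq : ∀ᶠ t in 𝓝 (0 : ℂ), y₁ t = y₂ (ζ * t)) : HasContact C₁ C₂ ⊤ := by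
  filter_upwards [self_mem_nhdsWithin] with ε hε
  have hmul : Tendsto (fun t : ℂ => ζ * t) (𝓝 0) (𝓝 0) := by
    have : ContinuousAt (fun t : ℂ => ζ * t) 0 := by fun_prop
    simpa [ContinuousAt] using this
  have hall : ∀ᶠ t in 𝓝[≠] (0 : ℂ), y₁ t = y₂ (ζ * t) ∧ E (t ^ N, y₁ t) ∈ C₁ ∧
      E ((ζ * t) ^ N, y₂ (ζ * t)) ∈ C₂ ∧ E (t ^ N, y₁ t) ∈ closedBall (0 : Plane) ε :=
    nhdsWithin_le_nhds (heq.and (h₁.eventually_mem.and ((hmul.eventually h₂.eventually_mem).and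
      (h₁.tendsto_param.eventually (closedBall_mem_nhds 0 hε)))))
  obtain ⟨t, ⟨h3, h4, h5, h6⟩, ht⟩ := (hall.and self_mem_nhdsWithin).exists
  rw [mul_pow, hζ, one_mul, ← h3] at h5
  exact tendsto_top_of_mem_inter ⟨h4, h6⟩ ⟨h5, h6⟩ (param_ne_zero E N y₁ ht)

/-- A distance comparable to `|t|^κ` is comparable to `r^(κ/N)`, since points of parameter `t` have
norm comparable to `|t|ᴺ`. -/
theorem hasContact_of_separation {C₁ C₂ : Set Plane} {E : (ℂ × ℂ) ≃L[ℂ] Plane} {N : ℕ}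
    {y₁ y₂ : ℂ → ℂ} {K : ℝ} (h₁ : IsParametrized C₁ E N y₁) (h₂ : IsParametrized C₂ E N y₂)
    (hK₁ : ∀ᶠ t in 𝓝 (0 : ℂ), ‖y₁ t‖ ≤ K * ‖t‖ ^ N) (hK₂ : ∀ᶠ t in 𝓝 (0 : ℂ), ‖y₂ t‖ ≤ K * ‖t‖ ^ N)
    {κ : ℕ} {c C r₀ : ℝ} (hc : 0 < c) (hr₀ : 0 < r₀)
    (hlow : ∀ t s : ℂ, ‖t‖ < r₀ → ‖s‖ < r₀ → c * ‖t‖ ^ κ ≤ ‖(t ^ N, y₁ t) - (s ^ N, y₂ s)‖)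
    (hup : ∀ t : ℂ, ‖t‖ < r₀ →
      ∃ s : ℂ, ‖s‖ = ‖t‖ ∧ ‖(t ^ N, y₁ t) - (s ^ N, y₂ s)‖ ≤ C * ‖t‖ ^ κ) :
    HasContact C₁ C₂ (((κ / N : ℝ)) : EReal) := by
  have hN : N ≠ 0 := h₁.ne_zero
  have hNR : (N : ℝ) ≠ 0 := by exact_mod_cast hN
  -- bounds for `E` and its inverse
  obtain ⟨B, hB0, hB⟩ : ∃ B : ℝ, 0 < B ∧ ∀ q, ‖E q‖ ≤ B * ‖q‖ :=
    (E : (ℂ × ℂ) →L[ℂ] Plane).bound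
  obtain ⟨b, hb0, hb⟩ : ∃ b : ℝ, 0 < b ∧ ∀ q, ‖q‖ ≤ b * ‖E q‖ := by
    obtain ⟨b, hb0, hb⟩ := (E.symm : Plane →L[ℂ] (ℂ × ℂ)).bound
    exact ⟨b, hb0, fun q => by simpa using hb (E q)⟩
  set A := B * (1 + |K|) with hA
  have hA0 : 0 < A := by positivity
  have hsize : ∀ (y : ℂ → ℂ) (t : ℂ), ‖y t‖ ≤ K * ‖t‖ ^ N → ‖E (t ^ N, y t)‖ ≤ A * ‖t‖ ^ N := by
    intro y t hy
    refine (hB _).trans ?_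
    rw [hA, mul_assoc]
    refine mul_le_mul_of_nonneg_left ?_ hB0.le
    rw [Prod.norm_mk, norm_pow]
    have h3 : K * ‖t‖ ^ N ≤ |K| * ‖t‖ ^ N :=
      mul_le_mul_of_nonneg_right (le_abs_self K) (by positivity)
    have h4 : 0 ≤ |K| * ‖t‖ ^ N := by positivity
    have h5 : 0 ≤ ‖t‖ ^ N := by positivity
    rw [add_mul, one_mul]
    exact max_le (by linarith) (by linarith)
  have hpow : ∀ t : ℂ, ‖t‖ ^ κ = (‖t‖ ^ N) ^ (κ / N : ℝ) := by
    intro t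
    rw [← Real.rpow_natCast, ← Real.rpow_natCast, ← Real.rpow_mul (norm_nonneg _),
      mul_div_cancel₀ _ hNR]
  have hgood : ∀ {y : ℂ → ℂ}, (∀ᶠ t in 𝓝 (0 : ℂ), ‖y t‖ ≤ K * ‖t‖ ^ N) →
      ∀ᶠ t in 𝓝 (0 : ℂ), ‖t‖ < r₀ ∧ ‖y t‖ ≤ K * ‖t‖ ^ N := by
    intro y hy
    filter_upwards [hy, ball_mem_nhds (0 : ℂ) hr₀] with t h3 h4
    exact ⟨by simpa using h4, h3⟩
  obtain ⟨ε₀, hε₀, hball⟩ := Metric.eventually_nhds_iff_ball.1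
    ((h₁.eventually_exists_param (hgood hK₁)).and (h₂.eventually_exists_param (hgood hK₂)))
  obtain ⟨r₁, hr₁, hmem⟩ := Metric.eventually_nhds_iff_ball.1
    ((hgood hK₁).and ((hgood hK₂).and (h₁.eventually_mem.and h₂.eventually_mem)))
  simp only [mem_ball_zero_iff] at hball hmem
  filter_upwards [eventually_pos_and_lt hε₀] with ε hε
  refine tendsto_log_div_log (c := c / b * A⁻¹ ^ (κ / N : ℝ)) (C := B * C * b ^ (κ / N : ℝ))
    (by positivity) ?_ ?_
  · filter_upwards [self_mem_nhdsWithin] with r hr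
    have hr : 0 < r := hr
    refine le_gap ?_
    rintro p ⟨hp, hpε⟩ q ⟨hq, hqε⟩ hpr -
    rw [mem_closedBall_zero_iff] at hpε hqε
    obtain ⟨t, ⟨ht, hyt⟩, rfl⟩ := (hball p (hpε.trans_lt hε.2)).1 hp
    obtain ⟨s, ⟨hs, -⟩, rfl⟩ := (hball q (hqε.trans_lt hε.2)).2 hq
    rw [edist_dist, dist_eq_norm]
    refine ENNReal.ofReal_le_ofReal ?_
    have h3 : A⁻¹ * r ≤ ‖t‖ ^ N := by
      rw [inv_mul_le_iff₀ hA0]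
      exact hpr.trans (hsize y₁ t hyt)
    have h4 : A⁻¹ ^ (κ / N : ℝ) * r ^ (κ / N : ℝ) ≤ ‖t‖ ^ κ := by
      rw [hpow, ← Real.mul_rpow (by positivity) hr.le]
      exact Real.rpow_le_rpow (by positivity) h3 (by positivity)
    have h5 := hb ((t ^ N, y₁ t) - (s ^ N, y₂ s))
    rw [map_sub] at h5
    rw [mul_assoc, div_mul_eq_mul_div, div_le_iff₀' hb0]
    exact (mul_le_mul_of_nonneg_left h4 hc.le).trans ((hlow t s ht hs).trans h5)
  · have hδ : 0 < min (ε / (A * b)) (r₁ ^ N / b) := by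
      have := hε.1
      positivity
    filter_upwards [eventually_pos_and_lt hδ] with r hr
    obtain ⟨hr0, hrlt⟩ := hr
    rw [lt_min_iff, lt_div_iff₀ (by positivity), lt_div_iff₀ hb0] at hrlt
    -- a parameter `t` with `|t|ᴺ = b r`, so that `‖E (tᴺ, y t)‖ ≥ r`
    obtain ⟨t, ht⟩ : ∃ t : ℂ, t ^ N = ((b * r : ℝ) : ℂ) := ⟨_, cpow_nat_inv_pow _ hN⟩
    have htn : ‖t‖ ^ N = b * r := by
      rw [← norm_pow, ht, norm_real, Real.norm_of_nonneg (by positivity)]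
    have htr : ‖t‖ < r₁ := lt_of_pow_lt_pow_left₀ N hr₁.le (by rw [htn]; linarith)
    obtain ⟨⟨htr₀, hyt⟩, -, htC, -⟩ := hmem t htr
    obtain ⟨s, hst, hs⟩ := hup t htr₀
    obtain ⟨-, ⟨-, hys⟩, -, hsC⟩ := hmem s (by rwa [hst])
    have hin : ∀ (y : ℂ → ℂ) (w : ℂ), ‖w‖ = ‖t‖ → ‖y w‖ ≤ K * ‖w‖ ^ N →
        r ≤ ‖E (w ^ N, y w)‖ ∧ E (w ^ N, y w) ∈ closedBall (0 : Plane) ε := by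
      intro y w hw hyw
      constructor
      · have h3 := (norm_fst_le (w ^ N, y w)).trans (hb _)
        simp only [norm_pow] at h3
        rw [hw, htn] at h3
        exact le_of_mul_le_mul_left h3 hb0
      · rw [mem_closedBall_zero_iff]
        refine (hsize y w hyw).trans ?_
        rw [hw, htn]
        linarith [mul_comm r (A * b)]
    obtain ⟨h3, h4⟩ := hin y₁ t rfl hyt
    obtain ⟨h5, h6⟩ := hin y₂ s hst hys
    refine (gap_le (Set.mem_inter htC h4) (Set.mem_inter hsC h6) h3 h5).trans ?_
    rw [edist_dist, dist_eq_norm, ← map_sub]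
    refine ENNReal.ofReal_le_ofReal ((hB _).trans ?_)
    rw [mul_assoc, mul_assoc, ← Real.mul_rpow hb0.le hr0.le, ← htn, ← hpow]
    exact mul_le_mul_of_nonneg_left hs hB0.le

/-- The contact of two plane branches exists; it is a nonnegative real number or `+∞`. -/
theorem exists_hasContact {C₁ C₂ : Set Plane} (h₁ : IsPlaneBranch C₁) (h₂ : IsPlaneBranch C₂) :
    ∃ c : EReal, HasContact C₁ C₂ c ∧ (c = ⊤ ∨ ∃ x : ℝ, 0 ≤ x ∧ c = x) := by
  obtain ⟨E, N, y₁, y₂, K, hp₁, hp₂, hK₁, hK₂⟩ := exists_common_parametrization h₁ h₂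
  by_cases hne : ∃ ζ : ℂ, ζ ^ N = 1 ∧ ∀ᶠ t in 𝓝 (0 : ℂ), y₁ t = y₂ (ζ * t)
  · obtain ⟨ζ, hζ, h⟩ := hne
    exact ⟨⊤, hasContact_top_of_rotation hp₁ hp₂ hζ h, Or.inl rfl⟩
  · obtain ⟨κ, c, C, r, hc, hr, hlow, hup⟩ := exists_separation hp₁.analyticAt hp₂.analyticAt
      hp₁.ne_zero hK₂ (fun ζ hζ h => hne ⟨ζ, hζ, h⟩)
    exact ⟨_, hasContact_of_separation hp₁ hp₂ hK₁ hK₂ hc hr hlow hup,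
      Or.inr ⟨_, by positivity, rfl⟩⟩

/-! ### Hölder homeomorphisms respect branches -/

theorem isPreconnected_ball_diff_zero {ρ : ℝ} (hρ : 0 < ρ) :
    IsPreconnected (ball (0 : ℂ) ρ \ {0}) := by
  have h : ball (0 : ℂ) ρ \ {0} = exp '' {z : ℂ | z.re < Real.log ρ} := by
    ext w
    constructor
    · rintro ⟨h1, h2⟩
      have h2 : w ≠ 0 := h2
      refine ⟨log w, ?_, exp_log h2⟩
      rw [Set.mem_ofPred_eq, log_re]
      exact Real.log_lt_log (norm_pos_iff.2 h2) (by simpa using h1)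
    · rintro ⟨z, hz, rfl⟩
      refine ⟨?_, exp_ne_zero z⟩
      rw [mem_ball_zero_iff, norm_exp, ← Real.exp_log hρ]
      exact Real.exp_lt_exp.2 hz
  rw [h]
  exact (convex_halfSpace_re_lt _).isPreconnected.image _ continuous_exp.continuousOn

/-- A branch minus the origin is connected, in arbitrarily small neighbourhoods of the origin: it
is the image of a punctured disc. -/
theorem IsParametrized.exists_isPreconnected {C : Set Plane} {E : (ℂ × ℂ) ≃L[ℂ] Plane} {N : ℕ}
    {y : ℂ → ℂ} (h : IsParametrized C E N y) {W : Set Plane} (hW : W ∈ 𝓝 (0 : Plane)) :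
    ∃ S : Set Plane, S ⊆ C ∩ W ∧ (0 : Plane) ∉ S ∧ IsPreconnected S ∧
      ∀ᶠ p in 𝓝 (0 : Plane), p ∈ C → p ≠ 0 → p ∈ S := by
  obtain ⟨ρ, hρ, hball⟩ := Metric.eventually_nhds_iff_ball.1
    (h.eventually_mem.and ((h.tendsto_param.eventually hW).and h.analyticAt.eventually_analyticAt))
  refine ⟨(fun t : ℂ => E (t ^ N, y t)) '' (ball 0 ρ \ {0}), ?_, ?_, ?_, ?_⟩
  · rintro _ ⟨t, ⟨ht, -⟩, rfl⟩
    exact ⟨(hball t ht).1, (hball t ht).2.1⟩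
  · rintro ⟨t, ⟨-, ht⟩, h0⟩
    exact param_ne_zero E N y ht h0
  · refine (isPreconnected_ball_diff_zero hρ).image _ fun t ht => ContinuousAt.continuousWithinAt ?_
    exact E.continuous.continuousAt.comp
      ((continuousAt_id.pow N).prodMk (hball t ht.1).2.2.continuousAt)
  · filter_upwards [h.eventually_exists_param (ball_mem_nhds (0 : ℂ) hρ)] with p hp hpC hp0
    obtain ⟨t, ht, rfl⟩ := hp hpC
    refine ⟨t, ⟨ht, fun h0 => hp0 ?_⟩, rfl⟩
    have h0 : t = 0 := h0
    simp [h0, h.ne_zero, h.apply_zero, Prod.mk_zero_zero]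

theorem IsPlaneBranch.exists_isParametrized' {C : Set Plane} (h : IsPlaneBranch C) :
    ∃ E N y, IsParametrized C E N y := by
  obtain ⟨μ, hμ⟩ := h.exists_shear
  exact ⟨_, h.exists_isParametrized _ hμ⟩

theorem IsPlaneBranch.zero_mem {C : Set Plane} (h : IsPlaneBranch C) : (0 : Plane) ∈ C := by
  obtain ⟨E, N, y, hp⟩ := h.exists_isParametrized'
  exact hp.zero_mem

theorem IsPlaneBranch.exists_mem_ne_zero {C : Set Plane} (h : IsPlaneBranch C) {P : Plane → Prop}
    (hP : ∀ᶠ p in 𝓝 (0 : Plane), P p) : ∃ p ∈ C, p ≠ 0 ∧ P p := by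
  obtain ⟨E, N, y, hp⟩ := h.exists_isParametrized'
  have hev : ∀ᶠ t in 𝓝[≠] (0 : ℂ), E (t ^ N, y t) ∈ C ∧ P (E (t ^ N, y t)) :=
    nhdsWithin_le_nhds (hp.eventually_mem.and (hp.tendsto_param.eventually hP))
  obtain ⟨t, ⟨h1, h2⟩, h3⟩ := (hev.and self_mem_nhdsWithin).exists
  exact ⟨_, h1, param_ne_zero E N y h3, h2⟩

theorem IsPlaneBranch.eventually_isClosed {C : Set Plane} (h : IsPlaneBranch C) :
    ∀ᶠ ε in 𝓝[>] (0 : ℝ), IsClosed (C ∩ closedBall 0 ε) := by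
  obtain ⟨F, hF, hFC⟩ := h
  obtain ⟨r, hr, hball⟩ := Metric.eventually_nhds_iff_ball.1
    (hFC.and hF.analyticAt.eventually_analyticAt)
  filter_upwards [eventually_pos_and_lt hr] with ε hε
  have hsub : closedBall (0 : Plane) ε ⊆ ball 0 r := closedBall_subset_ball hε.2
  have heq : C ∩ closedBall 0 ε = closedBall 0 ε ∩ F ⁻¹' {0} := by
    ext p
    constructor
    · rintro ⟨h1, h2⟩
      exact ⟨h2, (hball p (hsub h2)).1.1 h1⟩
    · rintro ⟨h1, h2⟩
      exact ⟨(hball p (hsub h1)).1.2 h2, h1⟩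
  rw [heq]
  refine ContinuousOn.preimage_isClosed_of_isClosed (fun p hp => ?_) isClosed_closedBall
    isClosed_singleton
  exact (hball p (hsub hp)).2.continuousAt.continuousWithinAt

/-- A pair of mutually inverse maps between neighbourhoods of `0` in `X` and `Y`, fixing `0` and
both `α`-Hölder with constant `K`. -/
structure HolderPair (α K : ℝ≥0) (X U Y V : Set Plane) (f g : Plane → Plane) : Prop where
  mem_left : U ∈ 𝓝 0
  mem_right : V ∈ 𝓝 0
  mapsTo_left : Set.MapsTo f (X ∩ U) (Y ∩ V)
  mapsTo_right : Set.MapsTo g (Y ∩ V) (X ∩ U)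
  left_inv : ∀ p ∈ X ∩ U, g (f p) = p
  right_inv : ∀ q ∈ Y ∩ V, f (g q) = q
  left_zero : f 0 = 0
  right_zero : g 0 = 0
  holder_left : HolderOnWith K α f (X ∩ U)
  holder_right : HolderOnWith K α g (Y ∩ V)

theorem HolderPair.symm {α K : ℝ≥0} {X U Y V : Set Plane} {f g : Plane → Plane}
    (h : HolderPair α K X U Y V f g) : HolderPair α K Y V X U g f :=
  ⟨h.mem_right, h.mem_left, h.mapsTo_right, h.mapsTo_left, h.right_inv, h.left_inv, h.right_zero,
    h.left_zero, h.holder_right, h.holder_left⟩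

theorem IsHolderHomeomorphic.exists_holderPair {α : ℝ≥0} {X Y : Set Plane}
    (h : IsHolderHomeomorphic α X 0 Y 0) :
    ∃ K U V f g, HolderPair α K X U Y V f g := by
  classical
  obtain ⟨U, hU, V, hV, e, ⟨h0, he0⟩, ⟨K₁, hK₁⟩, K₂, hK₂⟩ := h
  let f : Plane → Plane := fun p => if hp : p ∈ X ∩ U then e ⟨p, hp⟩ else 0
  let g : Plane → Plane := fun q => if hq : q ∈ Y ∩ V then e.symm ⟨q, hq⟩ else 0
  have hf : ∀ p (hp : p ∈ X ∩ U), f p = e ⟨p, hp⟩ := fun p hp => dif_pos hp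
  have hg : ∀ q (hq : q ∈ Y ∩ V), g q = e.symm ⟨q, hq⟩ := fun q hq => dif_pos hq
  have hf0 : f 0 = 0 := (hf 0 h0).trans he0
  have hmf : Set.MapsTo f (X ∩ U) (Y ∩ V) := fun p hp => by rw [hf p hp]; exact (e _).2
  have hmg : Set.MapsTo g (Y ∩ V) (X ∩ U) := fun q hq => by rw [hg q hq]; exact (e.symm _).2
  have hgf : ∀ p ∈ X ∩ U, g (f p) = p := by
    intro p hp
    have h1 : (⟨f p, hmf hp⟩ : ↥(Y ∩ V)) = e ⟨p, hp⟩ := Subtype.ext (hf p hp)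
    rw [hg _ (hmf hp), h1, e.symm_apply_apply]
  have hfg : ∀ q ∈ Y ∩ V, f (g q) = q := by
    intro q hq
    have h1 : (⟨g q, hmg hq⟩ : ↥(X ∩ U)) = e.symm ⟨q, hq⟩ := Subtype.ext (hg q hq)
    rw [hf _ (hmg hq), h1, e.apply_symm_apply]
  refine ⟨max K₁ K₂, U, V, f, g, hU, hV, hmf, hmg, hgf, hfg, hf0, ?_, ?_, ?_⟩
  · have := hgf 0 h0
    rwa [hf0] at this
  · intro p hp q hq
    rw [hf p hp, hf q hq]
    exact (hK₁.mono (le_max_left K₁ K₂)) ⟨p, hp⟩ ⟨q, hq⟩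
  · intro p hp q hq
    rw [hg p hp, hg q hq]
    exact (hK₂.mono (le_max_right K₁ K₂)) ⟨p, hp⟩ ⟨q, hq⟩

namespace HolderPair

variable {α K : ℝ≥0} {X U Y V : Set Plane} {f g : Plane → Plane}

theorem eventually_left (h : HolderPair α K X U Y V f g) (hα : 0 < α) (h0 : (0 : Plane) ∈ X)
    {P : Plane → Prop} (hP : ∀ᶠ q in 𝓝 (0 : Plane), P q) :
    ∀ᶠ p in 𝓝 (0 : Plane), p ∈ X → p ∈ X ∩ U ∧ P (f p) := by
  have hc := (h.holder_left.continuousOn hα) 0 ⟨h0, mem_of_mem_nhds h.mem_left⟩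
  rw [ContinuousWithinAt, h.left_zero] at hc
  filter_upwards [eventually_nhdsWithin_iff.1 (hc.eventually hP), h.mem_left] with p h1 h2 hp
  exact ⟨⟨hp, h2⟩, h1 ⟨hp, h2⟩⟩

/-- The inverse map sends a branch of `Y`, near the origin, into one of two branches covering
`X`. -/
theorem eventually_mem_or {C₁ C₂ D : Set Plane} (h : HolderPair α K (C₁ ∪ C₂) U Y V f g)
    (hα : 0 < α) (h0 : (0 : Plane) ∈ Y) (hC₁ : IsPlaneBranch C₁) (hC₂ : IsPlaneBranch C₂)
    (hD : IsPlaneBranch D) (hDY : D ⊆ Y) {ε : ℝ} (hε : 0 < ε)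
    (hcl₁ : IsClosed (C₁ ∩ closedBall 0 ε)) (hcl₂ : IsClosed (C₂ ∩ closedBall 0 ε))
    (hsep : ∀ p ∈ C₁ ∩ closedBall 0 ε, p ∈ C₂ → p = 0) :
    (∀ᶠ q in 𝓝 (0 : Plane), q ∈ D → g q ∈ C₁) ∨ ∀ᶠ q in 𝓝 (0 : Plane), q ∈ D → g q ∈ C₂ := by
  obtain ⟨E, N, y, hp⟩ := hD.exists_isParametrized'
  obtain ⟨S, hSW, hS0, hSc, hSn⟩ := hp.exists_isPreconnected
    (h.symm.eventually_left hα h0 (closedBall_mem_nhds (0 : Plane) hε))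
  have hin : ∀ q ∈ S, q ∈ Y ∩ V ∧ g q ∈ closedBall (0 : Plane) ε := fun q hq =>
    (hSW hq).2 (hDY (hSW hq).1)
  have hcov : ∀ q ∈ S, g q ∈ C₁ ∪ C₂ := fun q hq => (h.mapsTo_right (hin q hq).1).1
  have hne : ∀ q ∈ S, g q ≠ 0 := by
    intro q hq hg0
    have := h.right_inv q (hin q hq).1
    rw [hg0, h.left_zero] at this
    exact hS0 (this ▸ hq)
  have himg : IsPreconnected (g '' S) :=
    hSc.image g ((h.holder_right.continuousOn hα).mono fun q hq => (hin q hq).1)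
  have hconcl : ∀ {C : Set Plane}, (0 : Plane) ∈ C → (∀ q ∈ S, g q ∈ C) →
      ∀ᶠ q in 𝓝 (0 : Plane), q ∈ D → g q ∈ C := by
    intro C hC hS
    filter_upwards [hSn] with q hq hqD
    rcases eq_or_ne q 0 with rfl | hq0
    · rwa [h.right_zero]
    · exact hS q (hq hqD hq0)
  by_cases h1 : ∀ q ∈ S, g q ∈ C₁
  · exact Or.inl (hconcl hC₁.zero_mem h1)
  by_cases h2 : ∀ q ∈ S, g q ∈ C₂
  · exact Or.inr (hconcl hC₂.zero_mem h2)
  push Not at h1 h2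
  obtain ⟨q₁, hq₁, hq₁'⟩ := h1
  obtain ⟨q₂, hq₂, hq₂'⟩ := h2
  obtain ⟨_, ⟨q, hq, rfl⟩, hp₁, hp₂⟩ := isPreconnected_closed_iff.1 himg _ _ hcl₁ hcl₂
    (by
      rintro _ ⟨q, hq, rfl⟩
      exact (hcov q hq).imp (fun h3 => ⟨h3, (hin q hq).2⟩) fun h3 => ⟨h3, (hin q hq).2⟩)
    ⟨g q₂, ⟨q₂, hq₂, rfl⟩, (hcov q₂ hq₂).resolve_right hq₂', (hin q₂ hq₂).2⟩
    ⟨g q₁, ⟨q₁, hq₁, rfl⟩, (hcov q₁ hq₁).resolve_left hq₁', (hin q₁ hq₁).2⟩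
  exact absurd (hsep _ hp₁ hp₂.1) (hne q hq)

/-- The inverse map cannot send both branches of `Y` into the same branch `C` of `X`, since it is
surjective near the origin. -/
theorem not_eventually_mem {C C' D₁ D₂ : Set Plane} (h : HolderPair α K X U (D₁ ∪ D₂) V f g)
    (hα : 0 < α) (hC' : IsPlaneBranch C') (hX : C' ⊆ X) {ε : ℝ} (hε : 0 < ε)
    (hsep : ∀ p ∈ C' ∩ closedBall 0 ε, p ∈ C → p = 0)
    (h₁ : ∀ᶠ q in 𝓝 (0 : Plane), q ∈ D₁ → g q ∈ C) : ¬ ∀ᶠ q in 𝓝 (0 : Plane), q ∈ D₂ → g q ∈ C := by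
  intro h₂
  obtain ⟨p, hpC', hp0, hp, hpε⟩ := hC'.exists_mem_ne_zero
    ((h.eventually_left hα (hX hC'.zero_mem) (h₁.and h₂)).and (closedBall_mem_nhds 0 hε))
  obtain ⟨hpU, h3, h4⟩ := hp (hX hpC')
  have h5 : g (f p) ∈ C := (h.mapsTo_left hpU).1.elim h3 h4
  rw [h.left_inv p hpU] at h5
  exact hp0 (hsep p ⟨hpC', hpε⟩ h5)

end HolderPair

theorem _root_.HolderOnWith.norm_sub_le {α K : ℝ≥0} {f : Plane → Plane} {s : Set Plane}
    (h : HolderOnWith K α f s) {p q : Plane} (hp : p ∈ s) (hq : q ∈ s) :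
    ‖f p - f q‖ ≤ K * ‖p - q‖ ^ (α : ℝ) := by
  have h1 := h p hp q hq
  rw [edist_dist, edist_dist, ENNReal.ofReal_rpow_of_nonneg dist_nonneg α.coe_nonneg,
    ← ENNReal.ofReal_coe_nnreal, ← ENNReal.ofReal_mul K.coe_nonneg,
    ENNReal.ofReal_le_ofReal_iff (by positivity), dist_eq_norm, dist_eq_norm] at h1
  exact h1

theorem exists_of_gap_lt {Γ₁ Γ₂ : Set Plane} {r : ℝ} {b : ℝ≥0∞} (h : gap Γ₁ Γ₂ r < b) :
    ∃ p ∈ Γ₁, ∃ q ∈ Γ₂, r ≤ ‖p‖ ∧ r ≤ ‖q‖ ∧ edist p q < b := by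
  by_contra! hn
  exact absurd h (not_lt.2 (le_gap hn))

/-- The Hölder estimate: a pair of `α`-Hölder maps matching the branches turns points of
`D₁`, `D₂` realizing a contact larger than `d` into points of `C₁`, `C₂` realizing a contact of at
least `α² d`. -/
theorem HolderPair.false_of_matching {α K : ℝ≥0} {C₁ C₂ D₁ D₂ U V : Set Plane}
    {f g : Plane → Plane} (h : HolderPair α K (C₁ ∪ C₂) U (D₁ ∪ D₂) V f g) (hα : 0 < α)
    (h0 : (0 : Plane) ∈ D₁) {c d : ℝ} {d' : EReal} (hC : HasContact C₁ C₂ c)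
    (hD : HasContact D₁ D₂ d') (hdd : (d : EReal) < d') (hcd : c < α * d * α)
    (h₁ : ∀ᶠ q in 𝓝 (0 : Plane), q ∈ D₁ → g q ∈ C₁)
    (h₂ : ∀ᶠ q in 𝓝 (0 : Plane), q ∈ D₂ → g q ∈ C₂) : False := by
  have hα' : (0 : ℝ) < α := hα
  obtain ⟨c', hcc', hc'd⟩ := exists_between hcd
  obtain ⟨ε, hCε, hε⟩ := (hC.and self_mem_nhdsWithin).exists
  have hε : 0 < ε := hε
  have hgood := (h.symm.eventually_left hα (Or.inl h0) (closedBall_mem_nhds (0 : Plane) hε)).and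
    (h₁.and h₂)
  obtain ⟨ρ, hρ, hball⟩ := Metric.eventually_nhds_iff_ball.1 hgood
  obtain ⟨ε', hDε', hε'0, hε'⟩ := (hD.and (eventually_pos_and_lt hρ)).exists
  have hin : ∀ q ∈ closedBall (0 : Plane) ε', q ∈ D₁ ∪ D₂ →
      (q ∈ (D₁ ∪ D₂) ∩ V ∧ g q ∈ closedBall (0 : Plane) ε) ∧ (q ∈ D₁ → g q ∈ C₁) ∧
        (q ∈ D₂ → g q ∈ C₂) := fun q hq hqD =>
    ⟨(hball q (closedBall_subset_ball hε' hq)).1 hqD, (hball q (closedBall_subset_ball hε' hq)).2⟩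
  have hK : (0 : ℝ) < K + 1 := by positivity
  -- the radius `r = (K + 1) s ^ α` on the side of `D₁ ∪ D₂`
  have hsub : Tendsto (fun s : ℝ => ((K : ℝ) + 1) * s ^ (α : ℝ)) (𝓝[>] 0) (𝓝[>] 0) := by
    refine tendsto_nhdsWithin_iff.2 ⟨?_, ?_⟩
    · have h2 : ContinuousAt (fun s : ℝ => ((K : ℝ) + 1) * s ^ (α : ℝ)) 0 :=
        continuousAt_const.mul (Real.continuousAt_rpow_const 0 (α : ℝ) (Or.inr hα'.le))
      have h3 := h2.tendsto.mono_left (nhdsWithin_le_nhds (s := Set.Ioi 0))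
      rwa [Real.zero_rpow hα'.ne', mul_zero] at h3
    · filter_upwards [self_mem_nhdsWithin] with s hs
      have hs : 0 < s := hs
      exact mul_pos hK (Real.rpow_pos_of_pos hs _)
  have hDr := hsub.eventually ((hDε'.eventually (eventually_gt_nhds hdd)).and
    (eventually_pos_and_lt one_pos))
  have hCs := hCε.eventually (eventually_lt_nhds (EReal.coe_lt_coe_iff.2 hcc'))
  obtain ⟨s, ⟨⟨hr1, hr0, hr⟩, hs1, hs0, hs⟩, hlt⟩ := ((hDr.and
    (hCs.and (eventually_pos_and_lt one_pos))).and
    (eventually_mul_rpow_lt hc'd ((K + 1) * (K + 1) ^ (d * α)))).exists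
  set r : ℝ := (K + 1) * s ^ (α : ℝ) with hrdef
  rw [lt_log_div_log_iff hr0 hr] at hr1
  rw [log_div_log_lt_iff hs0 hs] at hs1
  obtain ⟨q₁, ⟨hq₁, hb₁⟩, q₂, ⟨hq₂, hb₂⟩, hrq₁, hrq₂, hqq⟩ := exists_of_gap_lt hr1
  obtain ⟨⟨hv₁, hg₁⟩, hm₁, -⟩ := hin q₁ hb₁ (Or.inl hq₁)
  obtain ⟨⟨hv₂, hg₂⟩, -, hm₂⟩ := hin q₂ hb₂ (Or.inr hq₂)
  have hnorm : ∀ q ∈ (D₁ ∪ D₂) ∩ V, r ≤ ‖q‖ → s ≤ ‖g q‖ := by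
    intro q hq hrq
    have h3 := h.holder_left.norm_sub_le (h.mapsTo_right hq)
      (h.mapsTo_right ⟨Or.inl h0, mem_of_mem_nhds h.mem_right⟩)
    rw [h.right_inv q hq, h.right_zero, h.left_zero, sub_zero, sub_zero] at h3
    have h4 : (K + 1) * s ^ (α : ℝ) ≤ (K + 1) * ‖g q‖ ^ (α : ℝ) :=
      hrq.trans (h3.trans (mul_le_mul_of_nonneg_right (by linarith) (by positivity)))
    exact (Real.rpow_le_rpow_iff hs0.le (norm_nonneg _) hα').1 (le_of_mul_le_mul_left h4 hK)
  have hdist : ‖q₁ - q₂‖ ≤ r ^ d := by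
    rw [edist_dist, dist_eq_norm, ENNReal.ofReal_lt_ofReal_iff (Real.rpow_pos_of_pos hr0 d)] at hqq
    exact hqq.le
  have h5 : ‖g q₁ - g q₂‖ ≤ (K + 1) * (r ^ d) ^ (α : ℝ) :=
    (h.holder_right.norm_sub_le hv₁ hv₂).trans (mul_le_mul (by linarith)
      (Real.rpow_le_rpow (norm_nonneg _) hdist hα'.le) (by positivity) hK.le)
  have h6 : (K + 1) * (r ^ d) ^ (α : ℝ) = (K + 1) * (K + 1) ^ (d * α) * s ^ (α * d * α) := by
    rw [← Real.rpow_mul hr0.le, hrdef, Real.mul_rpow hK.le (by positivity),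
      ← Real.rpow_mul hs0.le, mul_assoc, mul_assoc (α : ℝ) d α]
  have h7 := gap_le (Set.mem_inter (hm₁ hq₁) hg₁) (Set.mem_inter (hm₂ hq₂) hg₂)
    (hnorm q₁ hv₁ hrq₁) (hnorm q₂ hv₂ hrq₂)
  have h8 := hs1.trans_le h7
  rw [edist_dist, dist_eq_norm, ENNReal.ofReal_lt_ofReal_iff_of_nonneg (by positivity)] at h8
  linarith

theorem HasContact.eventually_inter {C₁ C₂ : Set Plane} {c : EReal} (h : HasContact C₁ C₂ c)
    (hc : c ≠ ⊤) : ∀ᶠ ε in 𝓝[>] (0 : ℝ), ∀ p ∈ C₁ ∩ closedBall 0 ε, p ∈ C₂ → p = 0 := by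
  filter_upwards [h] with ε hε p hp hp₂
  by_contra hp0
  exact hc (tendsto_nhds_unique hε (tendsto_top_of_mem_inter hp ⟨hp₂, hp.2⟩ hp0))

/-- There is no `α`-Hölder pair between `C₁ ∪ C₂` and `D₁ ∪ D₂` if the contact `c` of `C₁`, `C₂`
is less than `α² d`, with `d` less than the contact of `D₁`, `D₂`. -/
theorem HolderPair.false_of_contact_lt {α K : ℝ≥0} {C₁ C₂ D₁ D₂ U V : Set Plane}
    {f g : Plane → Plane} (h : HolderPair α K (C₁ ∪ C₂) U (D₁ ∪ D₂) V f g) (hα : 0 < α)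
    (hC₁ : IsPlaneBranch C₁) (hC₂ : IsPlaneBranch C₂) (hD₁ : IsPlaneBranch D₁)
    (hD₂ : IsPlaneBranch D₂) {c d : ℝ} {d' : EReal} (hC : HasContact C₁ C₂ c)
    (hD : HasContact D₁ D₂ d') (hdd : (d : EReal) < d') (hcd : c < α * d * α) : False := by
  obtain ⟨ε, ⟨⟨hcl₁, hcl₂⟩, hsep⟩, hε⟩ := (((hC₁.eventually_isClosed.and
    hC₂.eventually_isClosed).and (hC.eventually_inter (EReal.coe_ne_top c))).and
    self_mem_nhdsWithin).exists
  have hsep' : ∀ p ∈ C₂ ∩ closedBall 0 ε, p ∈ C₁ → p = 0 := fun p hp hp₁ =>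
    hsep p ⟨hp₁, hp.2⟩ hp.1
  have h0 : (0 : Plane) ∈ D₁ ∪ D₂ := Or.inl hD₁.zero_mem
  have hor : ∀ {D}, IsPlaneBranch D → D ⊆ D₁ ∪ D₂ → _ := fun hD hDY =>
    h.eventually_mem_or hα h0 hC₁ hC₂ hD hDY hε hcl₁ hcl₂ hsep
  rcases hor hD₁ Set.subset_union_left, hor hD₂ Set.subset_union_right with ⟨h₁ | h₁, h₂ | h₂⟩
  · exact h.not_eventually_mem hα hC₂ Set.subset_union_right hε hsep' h₁ h₂
  · exact h.false_of_matching hα hD₁.zero_mem hC hD hdd hcd h₁ h₂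
  · rw [Set.union_comm C₁ C₂] at h
    exact h.false_of_matching hα hD₁.zero_mem hC.symm hD hdd hcd h₁ h₂
  · exact h.not_eventually_mem hα hC₁ Set.subset_union_left hε hsep h₁ h₂

/-- If the contacts of `C₁`, `C₂` and of `D₁`, `D₂` differ, some `α < 1` excludes `α`-Hölder pairs.
Here `C₁`, `C₂` have the smaller contact, which is therefore finite. -/
theorem exists_forall_not_holderPair {C₁ C₂ D₁ D₂ : Set Plane}
    (hC₁ : IsPlaneBranch C₁) (hC₂ : IsPlaneBranch C₂) (hD₁ : IsPlaneBranch D₁)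
    (hD₂ : IsPlaneBranch D₂) {c : ℝ} {d' : EReal} (hc : 0 ≤ c) (hC : HasContact C₁ C₂ c)
    (hD : HasContact D₁ D₂ d') (hlt : (c : EReal) < d') :
    ∃ α : ℝ≥0, 0 < α ∧ α < 1 ∧ ∀ K U V f g, ¬ HolderPair α K (C₁ ∪ C₂) U (D₁ ∪ D₂) V f g := by
  obtain ⟨d, hcd, hdd⟩ := EReal.lt_iff_exists_real_btwn.1 hlt
  have hcd : c < d := EReal.coe_lt_coe_iff.1 hcd
  have hd : 0 < d := hc.trans_lt hcd
  -- `α² d` is the midpoint of `c` and `d`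
  have hpos : 0 < (c + d) / (2 * d) := by positivity
  refine ⟨⟨√((c + d) / (2 * d)), Real.sqrt_nonneg _⟩, ?_, ?_, fun K U V f g h => ?_⟩
  · exact Real.sqrt_pos.2 hpos
  · refine (Real.sqrt_lt' one_pos).2 ?_
    rw [div_lt_iff₀ (by positivity)]
    linarith
  · refine h.false_of_contact_lt (Real.sqrt_pos.2 hpos) hC₁ hC₂ hD₁ hD₂ hC hD hdd ?_
    change c < √((c + d) / (2 * d)) * d * √((c + d) / (2 * d))
    rw [mul_right_comm, Real.mul_self_sqrt hpos.le]
    field_simp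
    linarith

end HolderCurves

theorem mainTheorem3 (C₁ C₂ D₁ D₂ : Set HolderCurves.Plane)
    (hC₁ : HolderCurves.IsPlaneBranch C₁) (hC₂ : HolderCurves.IsPlaneBranch C₂)
    (hD₁ : HolderCurves.IsPlaneBranch D₁) (hD₂ : HolderCurves.IsPlaneBranch D₂) :
    ∃ c d : EReal, HolderCurves.HasContact C₁ C₂ c ∧ HolderCurves.HasContact D₁ D₂ d ∧
      (c ≠ d → ∃ α : ℝ≥0, 0 < α ∧ α < 1 ∧
        ¬ HolderCurves.IsHolderHomeomorphic α (C₁ ∪ C₂) 0 (D₁ ∪ D₂) 0) := by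
  open HolderCurves in
  obtain ⟨c, hc, hc'⟩ := exists_hasContact hC₁ hC₂
  obtain ⟨d, hd, hd'⟩ := exists_hasContact hD₁ hD₂
  refine ⟨c, d, hc, hd, fun hne => ?_⟩
  rcases lt_or_gt_of_ne hne with hlt | hlt
  · obtain ⟨x, hx, rfl⟩ := hc'.resolve_left hlt.ne_top
    obtain ⟨α, hα, hα1, hno⟩ := exists_forall_not_holderPair hC₁ hC₂ hD₁ hD₂ hx hc hd hlt
    refine ⟨α, hα, hα1, fun h => ?_⟩
    obtain ⟨K, U, V, f, g, hfg⟩ := h.exists_holderPair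
    exact hno K U V f g hfg
  · obtain ⟨x, hx, rfl⟩ := hd'.resolve_left hlt.ne_top
    obtain ⟨α, hα, hα1, hno⟩ := exists_forall_not_holderPair hD₁ hD₂ hC₁ hC₂ hx hd hc hlt
    refine ⟨α, hα, hα1, fun h => ?_⟩
    obtain ⟨K, U, V, f, g, hfg⟩ := h.exists_holderPair
    exact hno K V U g f hfg.symm
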